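/- **Setting.** For every $k\ge 1$ fix an inner product $Q_k$ on $\mathbb C^k$, with balls $B_r(\mathbb C^k)=\{z: \sqrt{Q_k(z,z)}<r\}$, and an at most countable set $\mathcal L_k$ of nonzero linear forms $\mathbb C^k\to\mathbb C$ with real coefficients (i.e. mapping $\mathbb R^k$ to $\mathbb R$), such that $L\circ \mathrm{pr}_k\in\mathcal L_{k+1}$ for all $L\in\mathcal L_k$, where $\mathrm{pr}_k:\mathbb C^{k+1}\to\mathbb C^k$ is the projection onto the first $k$ coordinates. Let $\mathcal S_{\mathcal L_k}=\{L_1\cdots L_m : m\ge 1,\ L_i\in\mathcal L_k\}$. Let $\mathrm{BHol}(B_{1/n}(\mathbb C^k))$ be the real Banach space, with the supremum norm, of the bounded holomorphic functions on $B_{1/n}(\mathbb C^k)$ that are real at real points. For $P\in \mathcal S_{\mathcal L_k}$ let $\mathrm{Mer}_P(B_{1/n}(\mathbb C^k))=\{f/P : f\in \mathrm{BHol}(B_{1/n}(\mathbb C^k))\}$ with the norm $\|f/P\|=\|f\|_\infty$. Define the real locally convex inductive limits (finest locally convex vector space topology making the canonical maps of the steps continuous) $$\mathcal H(\mathbb C^k)=\varinjlim_n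 \mathrm{BHol}(B_{1/n}(\mathbb C^k)),\qquad \mathcal M_{\mathcal L}(\mathbb C^k)=\varinjlim_{(n,P)\in\mathbb N\times\mathcal S_{\mathcal L_k}}\mathrm{Mer}_P(B_{1/n}(\mathbb C^k)),$$ which are spaces of germs at $0$, and $$\mathcal M_{\Lambda}(\mathbb C^{\mathbb N})=\varinjlim_k \mathcal M_{\mathcal L}(\mathbb C^k)=\{f_k\circ\pi_k : k\ge1,\ f_k\in\mathcal M_{\mathcal L}(\mathbb C^k)\},$$ where $\pi_k:\mathbb C^{\mathbb N}\to\mathbb C^k$ is the projection onto the first $k$ coordinates. A (real) *Silva space* is a Hausdorff space that is the locally convex inductive limit of a sequence of real Banach spaces with injective compact linear bonding maps. **Proposition.** The space $\mathcal M_\Lambda(\mathbb C^{\mathbb N})$ is a Silva space. Moreover, for every map $\varphi:\mathcal M_\Lambda(\mathbb C^{\mathbb N})\to\mathbb C$ (linear or not), with restrictions $\varphi_k:\mathcal M_{\mathcal L}(\mathbb C^k)\to\mathbb C$, $\varphi_k(f)=\varphi(f\circ\pi_k)$, the following are equivalent: 1. $\varphi$ is continuous; 2. $\varphi_k$ is continuous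 for every $k$; 3. for every $k$, every finite family of nonzero linear forms $L_1,\dots,L_M:\mathbb C^k\to\mathbb C$ and every sequence $(f_n)$ in $\mathcal M_{\mathcal L}(\mathbb C^k)$ such that the germs $g_n=\prod_{m=1}^M L_m\cdot f_n$ lie in $\mathcal H(\mathbb C^k)$ and converge in $\mathcal H(\mathbb C^k)$ to some $g$, the germ $g/\prod_{m=1}^M L_m$ lies in $\mathcal M_{\mathcal L}(\mathbb C^k)$ and $$\varphi_k(f_n)\underset{n\to\infty}{\longrightarrow}\varphi_k\Big(\frac{g}{\prod_{m=1}^M L_m}\Big);$$ 4. the condition in 3 holds for all families with $L_1,\dots,L_M\in\mathcal L_k$. -/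

import Mathlib

open Filter Topology
open scoped BoundedContinuousFunction

noncomputable section

namespace MeroGerms

/-! ### Locally convex inductive limits and Silva spaces -/

/-- The finest locally convex vector space topology on `E` for which all the linear maps `I i`
are continuous (in Mathlib's order on topologies, finer means smaller). -/
@[reducible] def lcFinal {ι : Type*} {E : Type*} [AddCommGroup E] [Module ℝ E] {X : ι → Type*}
    [∀ i, AddCommGroup (X i)] [∀ i, Module ℝ (X i)] [∀ i, TopologicalSpace (X i)]
    (I : ∀ i, X i →ₗ[ℝ] E) : TopologicalSpace E :=
  sInf {t | @IsTopologicalAddGroup E t _ ∧ @ContinuousSMul ℝ E _ _ t ∧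
    @LocallyConvexSpace ℝ E _ _ _ _ t ∧ ∀ i, @Continuous (X i) E _ t (I i)}

/-- A real Silva space (or (DFS)-space): a Hausdorff space that is the locally convex inductive
limit of a sequence of real Banach spaces `X 0 → X 1 → ⋯` with compact injective bonding maps
(injectivity of the bonding maps is expressed by that of the canonical maps `I n`). -/
def IsSilva.{u} (E : Type u) [AddCommGroup E] [Module ℝ E] [tE : TopologicalSpace E] : Prop :=
  T2Space E ∧
  ∃ (X : ℕ → Type u) (_ : ∀ n, NormedAddCommGroup (X n)) (_ : ∀ n, NormedSpace ℝ (X n))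
    (_ : ∀ n, CompleteSpace (X n))
    (b : ∀ n, X n →L[ℝ] X (n + 1)) (I : ∀ n, X n →ₗ[ℝ] E),
    (∀ n, IsCompactOperator (b n)) ∧
    (∀ n, Function.Injective (I n)) ∧
    (∀ n x, I (n + 1) (b n x) = I n x) ∧
    (∀ y : E, ∃ n x, I n x = y) ∧
    tE = lcFinal I

/-! ### Germs at zero of functions defined off finitely many hyperplanes -/

/-- The filter on `E` whose sets are those that contain `U \ (H₁ ∪ ⋯ ∪ Hₘ)` for a neighbourhood
`U` of `0` and finitely many (closed, linear) hyperplanes `Hⱼ`. -/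
def genericNhds (E : Type*) [AddCommGroup E] [Module ℂ E] [TopologicalSpace E] : Filter E :=
  𝓝 0 ⊓ ⨅ (L : E →L[ℂ] ℂ) (_ : L ≠ 0), 𝓟 {z | L z ≠ 0}

/-- The ambient space of germs: functions on `E`, identified when they agree near `0` off
finitely many hyperplanes. A fraction `h / P` with `h` holomorphic near `0` and `P` a product
of nonzero linear forms has a well-defined class here, whatever values are chosen where `P = 0`,
and two such fractions have the same class iff they are equal as meromorphic germs. -/
abbrev PGerm (E : Type*) [AddCommGroup E] [Module ℂ E] [TopologicalSpace E] : Type _ :=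
  Germ (genericNhds E) ℂ

theorem tendsto_genericNhds {E F : Type*} [AddCommGroup E] [Module ℂ E] [TopologicalSpace E]
    [AddCommGroup F] [Module ℂ F] [TopologicalSpace F] (p : E →L[ℂ] F)
    (hp : Function.Surjective p) : Tendsto p (genericNhds E) (genericNhds F) := by
  refine tendsto_inf.2 ⟨?_, ?_⟩
  · have h : Tendsto p (𝓝 0) (𝓝 0) := by simpa using p.continuous.tendsto 0
    exact h.mono_left inf_le_left
  · refine tendsto_iInf.2 fun L => tendsto_iInf.2 fun hL => tendsto_principal.2 ?_
    have hne : L.comp p ≠ 0 := by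
      intro h0
      apply hL
      ext w
      obtain ⟨z, rfl⟩ := hp w
      simpa using congrArg (fun T : E →L[ℂ] ℂ => T z) h0
    have hm : {z | (L.comp p) z ≠ 0} ∈ genericNhds E :=
      mem_inf_of_right (mem_iInf_of_mem (L.comp p) (mem_iInf_of_mem hne (mem_principal_self _)))
    exact hm

/-- Pull-back `f ↦ f ∘ p` of germs along a surjective continuous linear map `p`. -/
def pullback {E F : Type*} [AddCommGroup E] [Module ℂ E] [TopologicalSpace E]
    [AddCommGroup F] [Module ℂ F] [TopologicalSpace F] (p : E →L[ℂ] F)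
    (hp : Function.Surjective p) : PGerm F →ₗ[ℝ] PGerm E where
  toFun f := f.compTendsto p (tendsto_genericNhds p hp)
  map_add' f g := by
    induction f using Germ.inductionOn with | _ f =>
    induction g using Germ.inductionOn with | _ g => rfl
  map_smul' c f := by
    induction f using Germ.inductionOn with | _ f => rfl

/-! ### Bounded holomorphic functions on balls -/

section FiniteDim

variable {d : ℕ}

/-- The open ball of radius `r` around `0` for the norm `√Q(z,z)` of an inner product `Q`. -/
def qball (Q : InnerProductSpace.Core ℂ (Fin d → ℂ)) (r : ℝ) : Set (Fin d → ℂ) :=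
  {z | Real.sqrt (Q.inner z z).re < r}

/-- Extension by zero of a function on `B` (only its values near `0` will matter). -/
def zeroExt (B : Set (Fin d → ℂ)) : (B →ᵇ ℂ) →ₗ[ℝ] ((Fin d → ℂ) → ℂ) where
  toFun f := Function.extend Subtype.val f 0
  map_add' f g := by
    funext z
    by_cases hz : z ∈ B
    · have h (u : B → ℂ) :
          Function.extend Subtype.val u (0 : (Fin d → ℂ) → ℂ) z = u ⟨z, hz⟩ :=
        Subtype.val_injective.extend_apply u (0 : (Fin d → ℂ) → ℂ) ⟨z, hz⟩
      simp [h]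
    · have h (u : B → ℂ) :
          Function.extend Subtype.val u (0 : (Fin d → ℂ) → ℂ) z = 0 :=
        Function.extend_apply' u (0 : (Fin d → ℂ) → ℂ) z (by rintro ⟨a, ha⟩; exact hz (ha ▸ a.2))
      simp [h]
  map_smul' c f := by
    funext z
    by_cases hz : z ∈ B
    · have h (u : B → ℂ) :
          Function.extend Subtype.val u (0 : (Fin d → ℂ) → ℂ) z = u ⟨z, hz⟩ :=
        Subtype.val_injective.extend_apply u (0 : (Fin d → ℂ) → ℂ) ⟨z, hz⟩
      simp [h]
    · have h (u : B → ℂ) :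
          Function.extend Subtype.val u (0 : (Fin d → ℂ) → ℂ) z = 0 :=
        Function.extend_apply' u (0 : (Fin d → ℂ) → ℂ) z (by rintro ⟨a, ha⟩; exact hz (ha ▸ a.2))
      simp [h]

/-- The real normed space (with the supremum norm) of bounded holomorphic functions on the ball
of radius `r` that take real values at the real points of the ball. -/
def BHol (Q : InnerProductSpace.Core ℂ (Fin d → ℂ)) (r : ℝ) : Submodule ℝ (qball Q r →ᵇ ℂ) where
  carrier := {f | DifferentiableOn ℂ (zeroExt (qball Q r) f) (qball Q r) ∧
    ∀ z : qball Q r, (∀ i, (z.1 i).im = 0) → (f z).im = 0}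
  zero_mem' := by
    refine ⟨?_, fun _ _ => by simp⟩
    rw [map_zero]
    exact differentiableOn_const 0
  add_mem' {f g} hf hg := by
    refine ⟨?_, fun z hz => by simp [hf.2 z hz, hg.2 z hz]⟩
    rw [map_add]
    exact hf.1.add hg.1
  smul_mem' c f hf := by
    refine ⟨?_, fun z hz => by simp [hf.2 z hz]⟩
    rw [map_smul]
    exact hf.1.const_smul c

/-- The germ of the fraction `f / P`, for `f` a bounded holomorphic function on a ball. -/
def fracGerm (Q : InnerProductSpace.Core ℂ (Fin d → ℂ)) (r : ℝ) (P : (Fin d → ℂ) → ℂ) :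
    BHol Q r →ₗ[ℝ] PGerm (Fin d → ℂ) where
  toFun f := ((fun z => zeroExt (qball Q r) f z / P z : (Fin d → ℂ) → ℂ) : PGerm (Fin d → ℂ))
  map_add' f g := by
    rw [← Germ.coe_add]
    congr 1
    funext z
    simp [add_div]
  map_smul' c f := by
    rw [RingHom.id_apply, ← Germ.coe_smul]
    congr 1
    funext z
    simp [mul_div_assoc]

/-! ### Holomorphic germs -/

/-- The real vector space of germs at `0` of holomorphic functions on `ℂᵈ` taking real values at
real points: the union (equivalently, since it is increasing, the sum) over `n ≥ 1` of the
bounded holomorphic functions on the balls of radius `1/n`. -/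
def Holo (Q : InnerProductSpace.Core ℂ (Fin d → ℂ)) : Submodule ℝ (PGerm (Fin d → ℂ)) :=
  ⨆ n : ℕ, LinearMap.range (fracGerm Q (1 / ((n : ℝ) + 1)) 1)

/-- The canonical map from the `n`-th step to the holomorphic germs. -/
def Holo.step (Q : InnerProductSpace.Core ℂ (Fin d → ℂ)) (n : ℕ) :
    BHol Q (1 / ((n : ℝ) + 1)) →ₗ[ℝ] Holo Q :=
  (fracGerm Q (1 / ((n : ℝ) + 1)) 1).codRestrict (Holo Q) fun f =>
    Submodule.mem_iSup_of_mem n (LinearMap.mem_range_self _ f)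

/-- Holomorphic germs carry the locally convex inductive limit topology. -/
instance (Q : InnerProductSpace.Core ℂ (Fin d → ℂ)) : TopologicalSpace (Holo Q) :=
  lcFinal (Holo.step Q)

/-! ### Meromorphic germs with prescribed linear poles -/

/-- The semigroup (without unit) generated by a set of linear forms: all products
`L₀ ⋯ Lₘ` with factors in `𝓛`. -/
def formProducts (𝓛 : Set ((Fin d → ℂ) →L[ℂ] ℂ)) : Set ((Fin d → ℂ) → ℂ) :=
  {P | ∃ (m : ℕ) (L : Fin (m + 1) → ((Fin d → ℂ) →L[ℂ] ℂ)),
    (∀ i, L i ∈ 𝓛) ∧ P = fun z => ∏ i, L i z}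

/-- The real vector space of germs `f / P`, with `P` a product of forms in `𝓛` and `f`
holomorphic near `0` and real at real points: the union (equivalently, since the family is
directed, the sum) over `n ≥ 1` and `P` of the spaces of fractions `f / P`, with `f` bounded
holomorphic on the ball of radius `1/n`. -/
def Mero (Q : InnerProductSpace.Core ℂ (Fin d → ℂ)) (𝓛 : Set ((Fin d → ℂ) →L[ℂ] ℂ)) :
    Submodule ℝ (PGerm (Fin d → ℂ)) :=
  ⨆ i : ℕ × formProducts 𝓛, LinearMap.range (fracGerm Q (1 / ((i.1 : ℝ) + 1)) i.2)

/-- The canonical map from the step `(n, P)`, which is the Banach space of fractions `f / P` with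
the norm `‖f / P‖ = ‖f‖`, identified with the space of the numerators `f`. -/
def Mero.step (Q : InnerProductSpace.Core ℂ (Fin d → ℂ)) (𝓛 : Set ((Fin d → ℂ) →L[ℂ] ℂ))
    (i : ℕ × formProducts 𝓛) : BHol Q (1 / ((i.1 : ℝ) + 1)) →ₗ[ℝ] Mero Q 𝓛 :=
  (fracGerm Q (1 / ((i.1 : ℝ) + 1)) i.2).codRestrict (Mero Q 𝓛) fun f =>
    Submodule.mem_iSup_of_mem i (LinearMap.mem_range_self _ f)

/-- Meromorphic germs carry the locally convex inductive limit topology. -/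
instance (Q : InnerProductSpace.Core ℂ (Fin d → ℂ)) (𝓛 : Set ((Fin d → ℂ) →L[ℂ] ℂ)) :
    TopologicalSpace (Mero Q 𝓛) :=
  lcFinal (Mero.step Q 𝓛)

end FiniteDim

/-! ### Infinitely many variables -/

/-- The projection of `ℂᵏ⁺²` onto the first `k + 1` coordinates. -/
def pr (k : ℕ) : (Fin (k + 2) → ℂ) →L[ℂ] (Fin (k + 1) → ℂ) :=
  ContinuousLinearMap.pi fun i => ContinuousLinearMap.proj i.castSucc

/-- The projection of `ℂ^ℕ` onto the first `k + 1` coordinates. -/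
def proj (k : ℕ) : (ℕ → ℂ) →L[ℂ] (Fin (k + 1) → ℂ) :=
  ContinuousLinearMap.pi fun i => ContinuousLinearMap.proj (i : ℕ)

theorem proj_surjective (k : ℕ) : Function.Surjective (proj k) := fun w =>
  ⟨fun j => if h : j < k + 1 then w ⟨j, h⟩ else 0, by
    ext i
    have hi : (i : ℕ) < k + 1 := i.2
    simp only [proj, ContinuousLinearMap.coe_pi', ContinuousLinearMap.proj_apply, dif_pos hi]⟩

/-- A compatible family of generating sets: `forms k` is an at most countable set of nonzero
linear forms with real coefficients on `ℂᵏ⁺¹`, and `L ∈ forms k` implies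
`L ∘ pr k ∈ forms (k + 1)`. Dimensions start at `1`, so index `k` stands for dimension `k + 1`. -/
structure GeneratingFamily where
  forms : ∀ k : ℕ, Set ((Fin (k + 1) → ℂ) →L[ℂ] ℂ)
  countable : ∀ k, (forms k).Countable
  ne_zero : ∀ k, ∀ L ∈ forms k, L ≠ 0
  real : ∀ k, ∀ L ∈ forms k, ∀ z : Fin (k + 1) → ℂ, (∀ i, (z i).im = 0) → (L z).im = 0
  comp_pr : ∀ k, ∀ L ∈ forms k, L.comp (pr k) ∈ forms (k + 1)

/-- Meromorphic germs on `ℂ^ℕ` with poles in the family: the union (equivalently, since it is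
increasing, the sum) over `k` of the spaces of germs `f ∘ proj k` with `f` a meromorphic germ
on `ℂᵏ⁺¹` with poles in `Λ.forms k`. -/
def MeroLim (Q : ∀ k : ℕ, InnerProductSpace.Core ℂ (Fin (k + 1) → ℂ)) (Λ : GeneratingFamily) :
    Submodule ℝ (PGerm (ℕ → ℂ)) :=
  ⨆ k : ℕ, (Mero (Q k) (Λ.forms k)).map (pullback (proj k) (proj_surjective k))

/-- The canonical inclusion `f ↦ f ∘ proj k` of the `k`-th step. -/
def MeroLim.incl (Q : ∀ k : ℕ, InnerProductSpace.Core ℂ (Fin (k + 1) → ℂ))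
    (Λ : GeneratingFamily) (k : ℕ) : Mero (Q k) (Λ.forms k) →ₗ[ℝ] MeroLim Q Λ :=
  ((pullback (proj k) (proj_surjective k)).comp (Mero (Q k) (Λ.forms k)).subtype).codRestrict
    (MeroLim Q Λ) fun f => Submodule.mem_iSup_of_mem k (Submodule.mem_map_of_mem f.2)

/-- Meromorphic germs on `ℂ^ℕ` carry the locally convex inductive limit topology. -/
instance (Q : ∀ k : ℕ, InnerProductSpace.Core ℂ (Fin (k + 1) → ℂ)) (Λ : GeneratingFamily) :
    TopologicalSpace (MeroLim Q Λ) :=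
  lcFinal (MeroLim.incl Q Λ)

/-- `φ` respects limits along the tuple `L` of linear forms on `ℂᵏ⁺¹`: whenever `fₙ` are
meromorphic germs such that the products `(∏ L) fₙ` are holomorphic and converge to `g` in the
space of holomorphic germs, the quotient `g / ∏ L` is one of the meromorphic germs considered and
`φₖ(fₙ) → φₖ(g / ∏ L)`, where `φₖ` is the restriction of `φ` to the `k`-th step. -/
def RespectsLimits (Q : ∀ k : ℕ, InnerProductSpace.Core ℂ (Fin (k + 1) → ℂ))
    (Λ : GeneratingFamily) (φ : MeroLim Q Λ → ℂ) (k : ℕ) {M : ℕ}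
    (L : Fin M → ((Fin (k + 1) → ℂ) →L[ℂ] ℂ)) : Prop :=
  ∀ (f : ℕ → Mero (Q k) (Λ.forms k)) (g : ℕ → Holo (Q k)) (g' : Holo (Q k)),
    (∀ n, (g n : PGerm (Fin (k + 1) → ℂ)) =
      ((fun z => ∏ m, L m z : (Fin (k + 1) → ℂ) → ℂ) : PGerm (Fin (k + 1) → ℂ)) *
        (f n : PGerm (Fin (k + 1) → ℂ))) →
    Tendsto g atTop (𝓝 g') →
    ∃ h : Mero (Q k) (Λ.forms k),
      (h : PGerm (Fin (k + 1) → ℂ)) = (g' : PGerm (Fin (k + 1) → ℂ)) /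
        ((fun z => ∏ m, L m z : (Fin (k + 1) → ℂ) → ℂ) : PGerm (Fin (k + 1) → ℂ)) ∧
      Tendsto (fun n => φ (MeroLim.incl Q Λ k (f n))) atTop (𝓝 (φ (MeroLim.incl Q Λ k h)))

end MeroGerms

end

/-!
All the spaces involved are locally convex inductive limits of countably many Banach spaces of
bounded holomorphic functions on balls, glued by compact maps. For `MeroLim` the steps are indexed
by the triples `(k, n, P)` (`MeroLim.step`): a numerator `f` on the ball of radius `1 / (n + 1)` in
`ℂ^(k+1)` gives the germ `(f / P) ∘ proj k`. Any two triples are dominated by a third one, the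
bonding map being `f ↦ R * (f ∘ p)` with `p` a coordinate projection and `R` a product of forms;
it is compact by Montel's theorem as soon as the target ball is small enough (`exists_compact_map`).
A countable directed system has a cofinal sequence, which gives the Silva space
(`IsCompactSystem.isSilva`).

The equivalences rest on two properties of limits of compact sequences. First, the locally convex
limit topology is the plain final topology (`isOpen_lcFinal_nat`), so that nonlinear maps may be
tested for continuity on the steps, which are metrizable; testing on sequences there recovers
continuity from the condition on convergent sequences. Second, a convergent sequence converges in
one of the steps (`IsCompactSystem.exists_tendsto`). Thus, if `gₙ = L₁ ⋯ L_M fₙ` converges in the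
holomorphic germs, it converges uniformly on a ball. A form `Lᵢ` proportional to a form of the
family can be put into the denominator. Any other one is coprime to all the denominators, so that
the numerators vanish on its kernel and are divisible by it; this division, given by a Cauchy
integral, is continuous (`eq_zero_on_ker_of_coprime`, `exists_division`,
`exists_common_denominator`). So the `fₙ` converge in a single step of the meromorphic germs
(`Mero.exists_step_tendsto`), where a continuous map can be applied.
-/

noncomputable section

namespace MeroGerms

/-! ### Locally convex final topologies -/

section LcFinal

variable {ι : Type*} {E : Type*} [AddCommGroup E] [Module ℝ E] {X : ι → Type*}
  [∀ i, AddCommGroup (X i)] [∀ i, Module ℝ (X i)] [∀ i, TopologicalSpace (X i)]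
  (I : ∀ i, X i →ₗ[ℝ] E)

theorem lcFinal_isTopologicalAddGroup : @IsTopologicalAddGroup E (lcFinal I) _ :=
  topologicalAddGroup_sInf fun _ h => h.1

theorem lcFinal_continuousSMul : @ContinuousSMul ℝ E _ _ (lcFinal I) :=
  continuousSMul_sInf fun _ h => h.2.1

theorem lcFinal_locallyConvexSpace : @LocallyConvexSpace ℝ E _ _ _ _ (lcFinal I) :=
  LocallyConvexSpace.sInf fun _ h => h.2.2.1

theorem continuous_lcFinal (i : ι) : @Continuous (X i) E _ (lcFinal I) (I i) :=
  continuous_sInf_rng.2 fun _ h => h.2.2.2 i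

variable {I}

theorem lcFinal_le {t : TopologicalSpace E} (h₁ : @IsTopologicalAddGroup E t _)
    (h₂ : @ContinuousSMul ℝ E _ _ t) (h₃ : @LocallyConvexSpace ℝ E _ _ _ _ t)
    (h : ∀ i, @Continuous (X i) E _ t (I i)) : lcFinal I ≤ t :=
  sInf_le ⟨h₁, h₂, h₃, h⟩

/-- Universal property of the locally convex final topology. -/
theorem continuous_lcFinal_dom {F : Type*} [AddCommGroup F] [Module ℝ F] [t : TopologicalSpace F]
    [IsTopologicalAddGroup F] [ContinuousSMul ℝ F] [LocallyConvexSpace ℝ F] (T : E →ₗ[ℝ] F)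
    (h : ∀ i, Continuous fun x => T (I i x)) : @Continuous E F (lcFinal I) t T := by
  rw [continuous_iff_le_induced]
  refine lcFinal_le (topologicalAddGroup_induced T) (continuousSMul_induced T)
    (LocallyConvexSpace.induced T) fun i => ?_
  exact continuous_induced_rng.2 (h i)

end LcFinal

/-- A convex balanced set whose preimages in all the steps are neighbourhoods of zero is a
neighbourhood of zero in the locally convex final topology. -/
theorem mem_nhds_lcFinal {ι : Type*} {E : Type*} [AddCommGroup E] [Module ℝ E] {X : ι → Type*}
    [∀ i, NormedAddCommGroup (X i)] [∀ i, NormedSpace ℝ (X i)] {I : ∀ i, X i →ₗ[ℝ] E}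
    (hsurj : ∀ y : E, ∃ i x, I i x = y) {V : Set E} (hconv : Convex ℝ V) (hbal : Balanced ℝ V)
    (h0 : (0 : E) ∈ V) (hV : ∀ i, I i ⁻¹' V ∈ 𝓝 (0 : X i)) : V ∈ @nhds E (lcFinal I) 0 := by
  have habs : Absorbent ℝ V := by
    intro y
    obtain ⟨i, x, rfl⟩ := hsurj y
    have h := (absorbent_nhds_zero (𝕜 := ℝ) (hV i)) x
    rw [absorbs_iff_eventually_cobounded_mapsTo] at h ⊢
    filter_upwards [h] with c hc
    intro z hz
    rw [Set.mem_singleton_iff.1 hz]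
    have hw : I i (c⁻¹ • x) ∈ V := hc (Set.mem_singleton x)
    rwa [map_smul] at hw
  let p : Seminorm ℝ E := gaugeSeminorm hbal hconv habs
  have hp : ∀ x, p x = gauge V x := fun _ => rfl
  let : SeminormedAddCommGroup E := p.toAddGroupSeminorm.toSeminormedAddCommGroup
  let : NormedSpace ℝ E := ⟨fun c x => (p.smul' c x).le⟩
  have hle : lcFinal I ≤ (inferInstance : TopologicalSpace E) := by
    refine lcFinal_le inferInstance inferInstance inferInstance fun i => ?_
    refine continuous_of_continuousAt_zero (I i) ?_
    rw [ContinuousAt, map_zero, tendsto_zero_iff_norm_tendsto_zero]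
    have hc : Continuous (p.comp (I i)) := by
      refine Seminorm.continuous' (r := 1) ?_
      filter_upwards [hV i] with x hx
      rw [Seminorm.mem_closedBall_zero, Seminorm.comp_apply, hp]
      exact gauge_le_one_of_mem hx
    have := hc.tendsto 0
    rw [map_zero] at this
    exact this
  have hmem : {x : E | p x < 1} ∈ 𝓝 (0 : E) := by
    have : Metric.ball (0 : E) 1 ∈ 𝓝 (0 : E) := Metric.ball_mem_nhds _ one_pos
    refine Filter.mem_of_superset this fun x hx => ?_
    rw [mem_ball_zero_iff] at hx
    exact hx
  refine Filter.mem_of_superset (nhds_mono hle hmem) ?_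
  exact setOfPred_gauge_lt_one_subset_self hconv h0 habs

/-! ### Inductive limits of sequences with compact bonding maps -/

section Sequence

variable {E : Type*} [AddCommGroup E] [Module ℝ E] {X : ℕ → Type*}
  [∀ n, NormedAddCommGroup (X n)] [∀ n, NormedSpace ℝ (X n)]
  {b : ∀ n, X n →L[ℝ] X (n + 1)} {I : ∀ n, X n →ₗ[ℝ] E}

open scoped Pointwise in
/-- A set with open preimages in all the steps contains, with zero, a convex balanced set whose
preimages are neighbourhoods of zero: it is the union of an increasing sequence of compact convex
sets, each one being the image of the previous one thickened by a small relatively compact ball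
coming from the previous step. -/
theorem exists_convex_balanced_subset (hb : ∀ n, IsCompactOperator (b n))
    (hbI : ∀ n x, I (n + 1) (b n x) = I n x) {U : Set E} (h0 : (0 : E) ∈ U)
    (hU : ∀ n, IsOpen (I n ⁻¹' U)) :
    ∃ V ⊆ U, Convex ℝ V ∧ Balanced ℝ V ∧ (0 : E) ∈ V ∧ ∀ n, I n ⁻¹' V ∈ 𝓝 (0 : X n) := by
  let T : ∀ n, Set (X n) → Prop := fun n K =>
    IsCompact K ∧ Convex ℝ K ∧ Balanced ℝ K ∧ (0 : X n) ∈ K ∧ K ⊆ I n ⁻¹' U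
  have step : ∀ n (K : {K // T n K}), ∃ K' : {K // T (n + 1) K},
      b n '' K.1 ⊆ K'.1 ∧ b n ⁻¹' K'.1 ∈ 𝓝 (0 : X n) := by
    rintro n ⟨K, hKc, hKconv, hKbal, hK0, hKU⟩
    have hK' : IsCompact (b n '' K) := hKc.image (b n).continuous
    have hK'U : b n '' K ⊆ I (n + 1) ⁻¹' U := by
      rintro _ ⟨x, hx, rfl⟩
      have := hKU hx
      simpa [hbI] using this
    obtain ⟨δ, hδ, hδU⟩ := hK'.exists_thickening_subset_open (hU (n + 1)) hK'U
    let C := closure (b n '' Metric.ball 0 1)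
    have hC : IsCompact C := (hb n).isCompact_closure_image_ball (f := (b n).toLinearMap) 1
    have hCconv : Convex ℝ C :=
      ((convex_ball (0 : X n) 1).linear_image (b n).toLinearMap).closure
    have hCbal : Balanced ℝ C := by
      refine Balanced.closure ?_
      rintro a ha _ ⟨_, ⟨x, hx, rfl⟩, rfl⟩
      exact ⟨a • x, balanced_ball_zero a ha ⟨x, hx, rfl⟩, map_smul _ _ _⟩
    have hC0 : (0 : X (n + 1)) ∈ C :=
      subset_closure ⟨0, Metric.mem_ball_self one_pos, map_zero _⟩
    obtain ⟨M, hM, hCM⟩ := hC.isBounded.exists_pos_norm_lt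
    have hε : 0 < δ / M := div_pos hδ hM
    refine ⟨⟨b n '' K + (δ / M) • C, hK'.add (hC.smul _), ?_, ?_, ?_, ?_⟩, ?_, ?_⟩
    · exact (hKconv.linear_image (b n).toLinearMap).add (hCconv.smul _)
    · refine Balanced.add ?_ (hCbal.smul _)
      rintro a ha _ ⟨_, ⟨x, hx, rfl⟩, rfl⟩
      exact ⟨a • x, hKbal a ha ⟨x, hx, rfl⟩, map_smul _ _ _⟩
    · exact ⟨0, ⟨0, hK0, map_zero _⟩, 0, ⟨0, hC0, smul_zero _⟩, add_zero _⟩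
    · rintro _ ⟨x, hx, _, ⟨y, hy, rfl⟩, rfl⟩
      refine hδU (Metric.mem_thickening_iff.2 ⟨x, hx, ?_⟩)
      have hy' := hCM y hy
      simp only [dist_eq_norm, add_sub_cancel_left, norm_smul, Real.norm_of_nonneg hε.le]
      rw [div_mul_eq_mul_div, div_lt_iff₀ hM]
      gcongr
    · rintro x hx
      exact ⟨x, hx, 0, ⟨0, hC0, smul_zero _⟩, add_zero _⟩
    · refine Filter.mem_of_superset (Metric.ball_mem_nhds 0 hε) fun x hx => ?_
      refine ⟨0, ⟨0, hK0, map_zero _⟩, b n x, ⟨(δ / M)⁻¹ • b n x, ?_, ?_⟩, zero_add _⟩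
      · refine subset_closure ⟨(δ / M)⁻¹ • x, ?_, map_smul _ _ _⟩
        rw [mem_ball_zero_iff] at hx ⊢
        rw [norm_smul, norm_inv, Real.norm_of_nonneg hε.le, inv_mul_lt_iff₀ hε]
        simpa using hx
      · exact smul_inv_smul₀ hε.ne' _
  choose nxt hnxt using step
  let K0 : {K // T 0 K} := ⟨{0}, isCompact_singleton, convex_singleton 0, by
    rintro a - _ ⟨x, rfl, rfl⟩; simp, rfl, by simpa using h0⟩
  let K : ∀ n, {K // T n K} := fun n => Nat.rec K0 (fun n k => nxt n k) n
  have hK : ∀ n, b n '' (K n).1 ⊆ (K (n + 1)).1 ∧ b n ⁻¹' (K (n + 1)).1 ∈ 𝓝 (0 : X n) :=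
    fun n => hnxt n (K n)
  have hmono : Monotone fun n => I n '' (K n).1 := by
    refine monotone_nat_of_le_succ fun n => ?_
    rintro _ ⟨x, hx, rfl⟩
    exact ⟨b n x, (hK n).1 ⟨x, hx, rfl⟩, hbI n x⟩
  refine ⟨⋃ n, I n '' (K n).1, ?_, ?_, ?_, ?_, ?_⟩
  · refine Set.iUnion_subset fun n => ?_
    rintro _ ⟨x, hx, rfl⟩
    exact (K n).2.2.2.2.2 hx
  · exact hmono.directed_le.convex_iUnion fun n => (K n).2.2.1.linear_image (I n)
  · refine balanced_iUnion fun n => ?_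
    rintro a ha _ ⟨_, ⟨x, hx, rfl⟩, rfl⟩
    exact ⟨a • x, (K n).2.2.2.1 a ha ⟨x, hx, rfl⟩, map_smul _ _ _⟩
  · exact Set.mem_iUnion.2 ⟨0, 0, (K 0).2.2.2.2.1, map_zero _⟩
  · intro n
    refine Filter.mem_of_superset (hK n).2 fun x hx => ?_
    exact Set.mem_iUnion.2 ⟨n + 1, b n x, hx, hbI n x⟩

theorem exists_transition (hbI : ∀ n x, I (n + 1) (b n x) = I n x) {n m : ℕ} (h : n ≤ m) :
    ∃ t : X n →L[ℝ] X m, ∀ x, I m (t x) = I n x := by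
  induction m, h using Nat.le_induction with
  | base => exact ⟨ContinuousLinearMap.id ℝ _, fun _ => rfl⟩
  | succ m _ ih =>
    obtain ⟨t, ht⟩ := ih
    exact ⟨(b m).comp t, fun x => by simp [hbI, ht]⟩

variable (hb : ∀ n, IsCompactOperator (b n)) (hbI : ∀ n x, I (n + 1) (b n x) = I n x)
  (hsurj : ∀ y : E, ∃ n x, I n x = y)

include hb hbI hsurj

/-- The locally convex inductive limit of a sequence with compact bonding maps carries the final
topology. -/
theorem isOpen_lcFinal_nat {U : Set E} :
    IsOpen[lcFinal I] U ↔ ∀ n, IsOpen (I n ⁻¹' U) := by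
  let : TopologicalSpace E := lcFinal I
  refine ⟨fun h n => h.preimage (continuous_lcFinal I n), fun h => ?_⟩
  have : IsTopologicalAddGroup E := lcFinal_isTopologicalAddGroup I
  rw [isOpen_iff_mem_nhds]
  intro y hy
  have hmap : (fun z => y + z) ⁻¹' U ∈ 𝓝 (0 : E) := by
    obtain ⟨V, hVU, hconv, hbal, h0, hV⟩ := exists_convex_balanced_subset (I := I)
      (U := (fun z => y + z) ⁻¹' U) hb hbI (by simpa using hy) (fun n => by
        obtain ⟨m, w, rfl⟩ := hsurj y
        obtain ⟨t, ht⟩ := exists_transition hbI (le_max_left n m)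
        obtain ⟨t', ht'⟩ := exists_transition hbI (le_max_right n m)
        have heq : I n ⁻¹' ((fun z => I m w + z) ⁻¹' U) =
            (fun x => t' w + t x) ⁻¹' (I (max n m) ⁻¹' U) := by
          ext x
          simp [ht, ht']
        rw [heq]
        exact (h _).preimage (by fun_prop))
    exact Filter.mem_of_superset (mem_nhds_lcFinal hsurj hconv hbal h0 hV) hVU
  have h1 := (continuous_sub_right y).tendsto y
  rw [sub_self] at h1
  filter_upwards [h1 hmap] with z hz
  simpa using hz

end Sequence

section Sequence

variable {E : Type*} [AddCommGroup E] [Module ℝ E] {X : ℕ → Type*}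
  [∀ n, NormedAddCommGroup (X n)] [∀ n, NormedSpace ℝ (X n)]
  {b : ∀ n, X n →L[ℝ] X (n + 1)} {I : ∀ n, X n →ₗ[ℝ] E}
  (hb : ∀ n, IsCompactOperator (b n)) (hbI : ∀ n x, I (n + 1) (b n x) = I n x)
  (hsurj : ∀ y : E, ∃ n x, I n x = y) (hI : ∀ n, Function.Injective (I n))

include hb hbI hsurj hI

theorem t2Space_lcFinal_nat : @T2Space E (lcFinal I) := by
  let : TopologicalSpace E := lcFinal I
  have : IsTopologicalAddGroup E := lcFinal_isTopologicalAddGroup I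
  have : T1Space E := by
    refine ⟨fun y => ⟨?_⟩⟩
    refine (isOpen_lcFinal_nat hb hbI hsurj).2 fun n => ?_
    refine IsClosed.isOpen_compl (s := I n ⁻¹' {y}) (self := ?_)
    refine Set.Subsingleton.isClosed fun x hx x' hx' => hI n ?_
    rw [Set.mem_preimage, Set.mem_singleton_iff] at hx hx'
    rw [hx, hx']
  infer_instance

/-- A null sequence in the limit is contained in the image of a ball of one of the steps.
Otherwise it has a subsequence that leaves each set of a fast increasing sequence of such images;
this subsequence does not accumulate in any step, so its complement is an open neighbourhood of
zero. -/
theorem exists_bound_of_tendsto_zero {u : ℕ → E}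
    (hu : Tendsto u atTop (@nhds E (lcFinal I) 0)) :
    ∃ n R, ∀ k, ∃ x : X n, ‖x‖ ≤ R ∧ I n x = u k := by
  -- The radii grow so fast that every bounded subset of a step is eventually swallowed.
  let c : ℕ → ℝ := fun n => Nat.rec 1 (fun n r => 2 * ((‖b n‖ + 1) * r)) n
  have hc0 : c 0 = 1 := rfl
  have hcs : ∀ n, c (n + 1) = 2 * ((‖b n‖ + 1) * c n) := fun _ => rfl
  have hcpos : ∀ n, 0 < c n := by
    intro n
    induction n with
    | zero => rw [hc0]; exact one_pos
    | succ n ih => rw [hcs]; have := norm_nonneg (b n); positivity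
  have hstep : ∀ n (x : X n) (r : ℝ), 0 ≤ r → ‖x‖ ≤ 2 * r * c n → ‖b n x‖ ≤ r * c (n + 1) := by
    intro n x r hr hx
    calc ‖b n x‖ ≤ ‖b n‖ * ‖x‖ := (b n).le_opNorm x
      _ ≤ (‖b n‖ + 1) * (2 * r * c n) := by gcongr; linarith
      _ = r * c (n + 1) := by rw [hcs]; ring
  have htrans : ∀ k m, ∃ N, ∀ x : X m, ‖x‖ ≤ 2 ^ k * c m →
      ∃ x' : X N, ‖x'‖ ≤ c N ∧ I N x' = I m x := by
    intro k
    induction k with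
    | zero => exact fun m => ⟨m, fun x hx => ⟨x, by simpa using hx, rfl⟩⟩
    | succ k ih =>
      intro m
      obtain ⟨N, hN⟩ := ih (m + 1)
      refine ⟨N, fun x hx => ?_⟩
      obtain ⟨x', hx', hIx'⟩ := hN (b m x) (hstep m x _ (by positivity) (by rwa [← pow_succ']))
      exact ⟨x', hx', hIx'.trans (hbI m x)⟩
  let D : ℕ → Set E := fun n => I n '' Metric.closedBall 0 (c n)
  have hDmono : Monotone D := by
    refine monotone_nat_of_le_succ fun n => ?_
    rintro _ ⟨x, hx, rfl⟩
    rw [mem_closedBall_zero_iff] at hx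
    refine ⟨b n x, ?_, hbI n x⟩
    rw [mem_closedBall_zero_iff, ← one_mul (c (n + 1))]
    refine hstep n x 1 zero_le_one ?_
    linarith [hcpos n]
  have hswallow : ∀ m (x : X m), ∃ N, I m '' Metric.ball x 1 ⊆ D N := by
    intro m x
    obtain ⟨k, hk⟩ := pow_unbounded_of_one_lt ((‖x‖ + 1) / c m) one_lt_two
    rw [div_lt_iff₀ (hcpos m)] at hk
    obtain ⟨N, hN⟩ := htrans k m
    refine ⟨N, ?_⟩
    rintro _ ⟨y, hy, rfl⟩
    obtain ⟨x', hx', hIx'⟩ := hN y (by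
      have h1 : ‖y‖ ≤ ‖x‖ + ‖y - x‖ := by simpa using norm_add_le x (y - x)
      rw [mem_ball_iff_norm] at hy
      linarith)
    exact ⟨x', by simpa using hx', hIx'⟩
  by_contra! hcon
  have hex : ∀ n, ∃ k, u k ∉ D n := by
    intro n
    obtain ⟨k, hk⟩ := hcon n (c n)
    refine ⟨k, ?_⟩
    rintro ⟨x, hx, hxk⟩
    exact hk x (by simpa using hx) hxk
  choose k hk using hex
  let S : Set E := Set.range fun n => u (k n)
  have hopen : IsOpen[lcFinal I] Sᶜ := by
    refine (isOpen_lcFinal_nat hb hbI hsurj).2 fun m => isOpen_iff_mem_nhds.2 fun x hx => ?_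
    obtain ⟨N, hN⟩ := hswallow m x
    have hfin : (Metric.ball x 1 ∩ I m ⁻¹' S).Finite := by
      have : (Metric.ball x 1 ∩ I m ⁻¹' S) ⊆
          I m ⁻¹' ((fun n => u (k n)) '' (Set.Iio N)) := by
        rintro y ⟨hy, n, hn⟩
        refine ⟨n, ?_, hn⟩
        by_contra hNn
        refine hk n (hDmono (not_lt.1 hNn) ?_)
        have h2 : u (k n) = I m y := hn
        rw [h2]
        exact hN ⟨y, hy, rfl⟩
      exact (((Set.finite_Iio N).image _).preimage (hI m).injOn).subset this
    have hx' : x ∉ Metric.ball x 1 ∩ I m ⁻¹' S := fun h => hx h.2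
    filter_upwards [Metric.ball_mem_nhds x one_pos, hfin.isClosed.isOpen_compl.mem_nhds hx']
      with y hy hy' hyS
    exact hy' ⟨hy, hyS⟩
  have h0 : (0 : E) ∈ Sᶜ := by
    rintro ⟨n, hn⟩
    refine hk n ⟨0, by simpa using (hcpos n).le, ?_⟩
    rw [map_zero]
    exact hn.symm
  have hev : ∀ᶠ j in atTop, u j ∈ Sᶜ := hu (@IsOpen.mem_nhds E (lcFinal I) 0 Sᶜ hopen h0)
  obtain ⟨J, hJ⟩ := eventually_atTop.1 hev
  have hlt : ∀ n, k n < J := fun n => by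
    by_contra h
    exact hJ (k n) (not_lt.1 h) ⟨n, rfl⟩
  have hall : ∀ y : E, ∃ N, y ∈ D N := by
    intro y
    obtain ⟨m, x, rfl⟩ := hsurj y
    obtain ⟨N, hN⟩ := hswallow m x
    exact ⟨N, hN ⟨x, Metric.mem_ball_self one_pos, rfl⟩⟩
  choose N hN using hall
  have hle : N (u (k ((Finset.range J).sup fun j => N (u j)))) ≤
      (Finset.range J).sup fun j => N (u j) :=
    Finset.le_sup (f := fun j => N (u j)) (Finset.mem_range.2 (hlt _))
  exact hk _ (hDmono hle (hN _))

/-- Null sequences in the limit of a sequence with compact bonding maps are null sequences of one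
of the steps. -/
theorem exists_tendsto_of_tendsto_zero {u : ℕ → E}
    (hu : Tendsto u atTop (@nhds E (lcFinal I) 0)) :
    ∃ n, ∃ x : ℕ → X n, (∀ k, I n (x k) = u k) ∧ Tendsto x atTop (𝓝 0) := by
  let : TopologicalSpace E := lcFinal I
  have : T2Space E := t2Space_lcFinal_nat hb hbI hsurj hI
  obtain ⟨n, R, hR⟩ := exists_bound_of_tendsto_zero hb hbI hsurj hI hu
  choose x hx hxu using hR
  let C := closure (b n '' Metric.closedBall 0 R)
  have hC : IsCompact C :=
    (hb n).isCompact_closure_image_closedBall (f := (b n).toLinearMap) R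
  have : CompactSpace C := isCompact_iff_compactSpace.1 hC
  have hR0 : 0 ≤ R := (norm_nonneg _).trans (hx 0)
  have hmem : ∀ y : X n, ‖y‖ ≤ R → b n y ∈ C := fun y hy =>
    subset_closure ⟨y, by simpa using hy, rfl⟩
  have hemb : IsClosedEmbedding fun z : C => I (n + 1) z.1 :=
    ((continuous_lcFinal I (n + 1)).comp continuous_subtype_val).isClosedEmbedding
      ((hI (n + 1)).comp Subtype.val_injective)
  refine ⟨n + 1, fun k => b n (x k), fun k => by rw [hbI, hxu], ?_⟩
  have h1 : Tendsto (fun k => (⟨b n (x k), hmem _ (hx k)⟩ : C)) atTop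
      (𝓝 ⟨b n 0, hmem 0 (by simpa using hR0)⟩) := by
    rw [hemb.isInducing.tendsto_nhds_iff]
    simpa [Function.comp_def, hbI, hxu] using hu
  simpa [Function.comp_def] using (continuous_subtype_val.tendsto _).comp h1

end Sequence

/-! ### Inductive limits of countable systems with compact bonding maps -/

section System

variable {ι : Type*} {E : Type*} [AddCommGroup E] [Module ℝ E] {X : ι → Type*}
  [∀ i, NormedAddCommGroup (X i)] [∀ i, NormedSpace ℝ (X i)]

/-- The step `i` of a family of normed spaces mapping to `E` is compactly included in the
step `j`. -/
def CompactLE (I : ∀ i, X i →ₗ[ℝ] E) (i j : ι) : Prop :=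
  ∃ b : X i →L[ℝ] X j, IsCompactOperator b ∧ ∀ x, I j (b x) = I i x

/-- A family of normed spaces mapping injectively to `E`, covering `E`, such that any two of its
members are compactly included in a third one. -/
structure IsCompactSystem (I : ∀ i, X i →ₗ[ℝ] E) : Prop where
  injective : ∀ i, Function.Injective (I i)
  surjective : ∀ y : E, ∃ i x, I i x = y
  directed : ∀ i j, ∃ l, CompactLE I i l ∧ CompactLE I j l

variable {I : ∀ i, X i →ₗ[ℝ] E}

/-- A countable directed system has a cofinal sequence. -/
theorem IsCompactSystem.exists_cofinal [Countable ι] [Nonempty ι] (h : IsCompactSystem I) :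
    ∃ s : ℕ → ι, (∀ n, CompactLE I (s n) (s (n + 1))) ∧ ∀ i, ∃ n, CompactLE I i (s n) := by
  obtain ⟨e, he⟩ := exists_surjective_nat ι
  choose l hl using h.directed
  let s : ℕ → ι := fun n => Nat.rec (e 0) (fun n i => l i (e n)) n
  have hs : ∀ n, s (n + 1) = l (s n) (e n) := fun _ => rfl
  refine ⟨s, fun n => hs n ▸ (hl (s n) (e n)).1, fun i => ?_⟩
  obtain ⟨n, rfl⟩ := he i
  exact ⟨n + 1, hs n ▸ (hl (s n) (e n)).2⟩

/-- A countable compact system has the same limit as a sequence of its members with compact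
bonding maps. -/
theorem IsCompactSystem.exists_sequence [Countable ι] [Nonempty ι] (h : IsCompactSystem I) :
    ∃ (s : ℕ → ι) (b : ∀ n, X (s n) →L[ℝ] X (s (n + 1))), (∀ n, IsCompactOperator (b n)) ∧
      (∀ n x, I (s (n + 1)) (b n x) = I (s n) x) ∧ (∀ y : E, ∃ n x, I (s n) x = y) ∧
      lcFinal I = lcFinal fun n => I (s n) := by
  obtain ⟨s, hs, hcof⟩ := h.exists_cofinal
  choose b hb hbI using hs
  refine ⟨s, b, hb, hbI, fun y => ?_, le_antisymm ?_ ?_⟩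
  · obtain ⟨i, x, rfl⟩ := h.surjective y
    obtain ⟨n, t, -, ht⟩ := hcof i
    exact ⟨n, t x, ht x⟩
  · refine lcFinal_le (lcFinal_isTopologicalAddGroup _) (lcFinal_continuousSMul _)
      (lcFinal_locallyConvexSpace _) fun i => ?_
    obtain ⟨n, t, -, ht⟩ := hcof i
    have heq : (I i : X i → E) = fun x => I (s n) (t x) := funext fun x => (ht x).symm
    rw [heq]
    let : TopologicalSpace E := lcFinal fun n => I (s n)
    exact (continuous_lcFinal (fun n => I (s n)) n).comp t.continuous
  · exact lcFinal_le (lcFinal_isTopologicalAddGroup _) (lcFinal_continuousSMul _)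
      (lcFinal_locallyConvexSpace _) fun n => continuous_lcFinal I (s n)

/-- The limit of a countable compact system carries the final topology, so that arbitrary maps
on it can be tested for continuity on the steps. -/
theorem IsCompactSystem.continuous_iff [Countable ι] [Nonempty ι] (h : IsCompactSystem I)
    {Y : Type*} [TopologicalSpace Y] {φ : E → Y} :
    @Continuous E Y (lcFinal I) _ φ ↔ ∀ i, Continuous fun x => φ (I i x) := by
  refine ⟨fun hφ i => @Continuous.comp _ _ _ _ (lcFinal I) _ _ _ hφ (continuous_lcFinal I i),
    fun hφ => ?_⟩
  obtain ⟨s, b, hb, hbI, hsurj, heq⟩ := h.exists_sequence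
  rw [heq]
  refine @Continuous.mk _ _ (lcFinal fun n => I (s n)) _ _ fun U hU => ?_
  exact (isOpen_lcFinal_nat hb hbI hsurj).2 fun n => hU.preimage (hφ (s n))

/-- Convergent sequences in the limit of a countable compact system converge in one of the
steps. -/
theorem IsCompactSystem.exists_tendsto [Countable ι] [Nonempty ι] (h : IsCompactSystem I)
    {u : ℕ → E} {y : E} (hu : Tendsto u atTop (@nhds E (lcFinal I) y)) :
    ∃ i, ∃ (x : ℕ → X i) (x₀ : X i), (∀ k, I i (x k) = u k) ∧ I i x₀ = y ∧
      Tendsto x atTop (𝓝 x₀) := by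
  obtain ⟨s, b, hb, hbI, hsurj, heq⟩ := h.exists_sequence
  have hu0 : Tendsto (fun k => u k - y) atTop (@nhds E (lcFinal fun n => I (s n)) 0) := by
    rw [← heq]
    let : TopologicalSpace E := lcFinal I
    have : IsTopologicalAddGroup E := lcFinal_isTopologicalAddGroup I
    simpa using hu.sub_const y
  obtain ⟨n, x, hx, hx0⟩ := exists_tendsto_of_tendsto_zero hb hbI hsurj (fun n => h.injective _) hu0
  obtain ⟨j, z, rfl⟩ := h.surjective y
  obtain ⟨l, ⟨t, -, ht⟩, t', -, ht'⟩ := h.directed (s n) j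
  refine ⟨l, fun k => t (x k) + t' z, t' z, fun k => ?_, ht' z, ?_⟩
  · rw [map_add, ht, hx, ht', sub_add_cancel]
  · simpa using ((t.continuous.tendsto 0).comp hx0).add_const (t' z)

end System

/-- The limit of a countable compact system of Banach spaces is a Silva space. -/
theorem IsCompactSystem.isSilva.{u} {ι : Type*} [Countable ι] [Nonempty ι] {E : Type u}
    [AddCommGroup E] [Module ℝ E] {X : ι → Type u}
    [∀ i, NormedAddCommGroup (X i)] [∀ i, NormedSpace ℝ (X i)] [∀ i, CompleteSpace (X i)]
    {I : ∀ i, X i →ₗ[ℝ] E} (h : IsCompactSystem I) : @IsSilva E _ _ (lcFinal I) := by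
  obtain ⟨s, b, hb, hbI, hsurj, heq⟩ := h.exists_sequence
  rw [heq]
  exact ⟨t2Space_lcFinal_nat hb hbI hsurj fun n => h.injective _, fun n => X (s n),
    fun n => inferInstance, fun n => inferInstance, fun n => inferInstance, b, fun n => I (s n),
    hb, fun n => h.injective _, hbI, hsurj, rfl⟩

/-! ### Holomorphic functions on normed spaces -/

section Holomorphic

variable {E : Type*} [NormedAddCommGroup E] [NormedSpace ℂ E]

/-- Cauchy's estimate for the first derivative. -/
theorem norm_fderiv_le_of_bounded {f : E → ℂ} {z : E} {R M : ℝ} (hR : 0 < R)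
    (hf : DifferentiableOn ℂ f (Metric.ball z R)) (hM : ∀ w ∈ Metric.ball z R, ‖f w‖ ≤ M) :
    ‖fderiv ℂ f z‖ ≤ 2 * M / R := by
  refine Complex.norm_fderiv_le_div_of_mapsTo_ball hf (fun w hw => ?_) hR
  rw [mem_closedBall_iff_norm]
  linarith [norm_sub_le (f w) (f z), hM w hw, hM z (Metric.mem_ball_self hR)]

/-- Bounded holomorphic functions are Lipschitz away from the boundary, with a constant that
depends only on the bound. -/
theorem dist_le_of_bounded {f : E → ℂ} {c : E} {R M : ℝ} (hR : 0 < R)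
    (hf : DifferentiableOn ℂ f (Metric.ball c (2 * R)))
    (hM : ∀ w ∈ Metric.ball c (2 * R), ‖f w‖ ≤ M) {x y : E}
    (hx : x ∈ Metric.ball c R) (hy : y ∈ Metric.ball c R) :
    dist (f x) (f y) ≤ 2 * M / R * dist x y := by
  have hsub : Metric.ball y R ⊆ Metric.ball c (2 * R) :=
    Metric.ball_subset_ball' (by rw [Metric.mem_ball] at hy; linarith)
  have hx2 : x ∈ Metric.ball c (2 * R) := Metric.ball_subset_ball (by linarith) hx
  have hy2 : y ∈ Metric.ball c (2 * R) := Metric.ball_subset_ball (by linarith) hy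
  have hdist : ∀ w ∈ Metric.ball c (2 * R), dist (f w) (f y) ≤ 2 * M := fun w hw => by
    rw [dist_eq_norm]
    linarith [norm_sub_le (f w) (f y), hM w hw, hM y hy2]
  by_cases hxy : x ∈ Metric.ball y R
  · exact Complex.dist_le_div_mul_dist_of_mapsTo_ball (hf.mono hsub)
      (fun w hw => hdist w (hsub hw)) hxy
  · rw [Metric.mem_ball, not_lt] at hxy
    have hM0 : 0 ≤ M := (norm_nonneg _).trans (hM x hx2)
    calc dist (f x) (f y) ≤ 2 * M := hdist x hx2
      _ = 2 * M / R * R := by field_simp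
      _ ≤ 2 * M / R * dist x y := by gcongr

/-- Uniform limits of holomorphic functions of several variables are holomorphic. -/
theorem differentiableOn_of_tendstoUniformlyOn {F : ℕ → E → ℂ} {f : E → ℂ} {s : Set E}
    (hs : IsOpen s) (hF : ∀ n, DifferentiableOn ℂ (F n) s)
    (h : TendstoUniformlyOn F f atTop s) : DifferentiableOn ℂ f s := by
  intro z hz
  obtain ⟨R, hR, hRs⟩ := Metric.isOpen_iff.1 hs z hz
  have hsub : ∀ w ∈ Metric.ball z (R / 2), Metric.ball w (R / 2) ⊆ s := fun w hw =>
    (Metric.ball_subset_ball' (by rw [Metric.mem_ball] at hw; linarith)).trans hRs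
  have hmem : ∀ w ∈ Metric.ball z (R / 2), w ∈ s := fun w hw =>
    hsub w hw (Metric.mem_ball_self (by linarith))
  have hdiff : ∀ n, ∀ w ∈ s, DifferentiableAt ℂ (F n) w := fun n w hw =>
    (hF n).differentiableAt (hs.mem_nhds hw)
  have hcauchy : UniformCauchySeqOn (fun n => fderiv ℂ (F n)) atTop (Metric.ball z (R / 2)) := by
    rw [Metric.uniformCauchySeqOn_iff]
    intro ε hε
    obtain ⟨N, hN⟩ := Metric.uniformCauchySeqOn_iff.1 h.uniformCauchySeqOn (ε * R / 8)
      (by positivity)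
    refine ⟨N, fun m hm n hn w hw => ?_⟩
    rw [dist_eq_norm, ← fderiv_sub (hdiff m w (hmem w hw)) (hdiff n w (hmem w hw))]
    have := norm_fderiv_le_of_bounded (M := ε * R / 8) (half_pos hR)
      (((hF m).sub (hF n)).mono (hsub w hw)) fun x hx => by
        have := hN m hm n hn x (hsub w hw hx)
        rw [dist_eq_norm] at this
        exact this.le
    refine this.trans_lt ?_
    have : 2 * (ε * R / 8) / (R / 2) = ε / 2 := by field_simp; ring
    linarith
  choose! g hg using fun w (hw : w ∈ Metric.ball z (R / 2)) =>
    cauchySeq_tendsto_of_complete (hcauchy.cauchySeq hw)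
  have hlim := hcauchy.tendstoUniformlyOn_of_tendsto hg
  exact (hasFDerivAt_of_tendstoUniformlyOn Metric.isOpen_ball hlim
    (fun n w hw => (hdiff n w (hmem w hw)).hasFDerivAt)
    (fun w hw => h.tendsto_at (hmem w hw))
    (Metric.mem_ball_self (half_pos hR))).differentiableAt.differentiableWithinAt

/-- The restriction of a holomorphic function to a complex line through zero is analytic. -/
theorem analyticOnNhd_line {f : E → ℂ} {s : Set E} (hs : IsOpen s) (hf : DifferentiableOn ℂ f s)
    (z : E) : AnalyticOnNhd ℂ (fun t : ℂ => f (t • z)) {t : ℂ | t • z ∈ s} := by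
  have hopen : IsOpen {t : ℂ | t • z ∈ s} := hs.preimage (by fun_prop)
  refine DifferentiableOn.analyticOnNhd (fun t ht => ?_) hopen
  have h1 : DifferentiableAt ℂ f (t • z) := hf.differentiableAt (hs.mem_nhds ht)
  have h2 : DifferentiableAt ℂ (fun t : ℂ => t • z) t := by fun_prop
  exact (DifferentiableAt.comp t h1 h2).differentiableWithinAt

/-- The identity theorem on a convex neighbourhood of zero. -/
theorem eqOn_zero_of_eventuallyEq_zero {f : E → ℂ} {s : Set E} (hs : IsOpen s)
    (hconv : Convex ℝ s) (h0 : (0 : E) ∈ s) (hf : DifferentiableOn ℂ f s)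
    (h : f =ᶠ[𝓝 0] 0) : Set.EqOn f 0 s := by
  intro z hz
  let ℓ : ℂ →ₗ[ℝ] E := (LinearMap.toSpanSingleton ℂ E z).restrictScalars ℝ
  have hpre : IsPreconnected {t : ℂ | t • z ∈ s} := (hconv.linear_preimage ℓ).isPreconnected
  have hev : (fun t : ℂ => f (t • z)) =ᶠ[𝓝 0] 0 := by
    have : Tendsto (fun t : ℂ => t • z) (𝓝 0) (𝓝 0) := by
      have h : Continuous fun t : ℂ => t • z := by fun_prop
      simpa using h.tendsto 0
    exact this.eventually h
  have := (analyticOnNhd_line hs hf z).eqOn_zero_of_preconnected_of_eventuallyEq_zero hpre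
    (by simpa using h0) hev
  simpa using this (show (1 : ℂ) • z ∈ s by simpa using hz)

/-- A holomorphic function on a convex neighbourhood of zero which is real on a real line near
zero is real on the whole line. -/
theorem im_eq_zero_of_eventually {f : E → ℂ} {s : Set E} (hs : IsOpen s)
    (hconv : Convex ℝ s) (h0 : (0 : E) ∈ s) (hf : DifferentiableOn ℂ f s) {z : E} (hz : z ∈ s)
    (h : ∀ᶠ t : ℝ in 𝓝 0, (f ((t : ℂ) • z)).im = 0) : (f z).im = 0 := by
  let ℓ : ℝ →ₗ[ℝ] E := LinearMap.toSpanSingleton ℝ E z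
  have hset : ∀ t : ℝ, (t : ℂ) • z = ℓ t := fun t => by
    simp [ℓ]
  have hpre : IsPreconnected {t : ℝ | ℓ t ∈ s} := (hconv.linear_preimage ℓ).isPreconnected
  have han : AnalyticOnNhd ℝ (fun t : ℝ => (f ((t : ℂ) • z)).im) {t : ℝ | ℓ t ∈ s} := by
    intro t ht
    have h1 := (analyticOnNhd_line hs hf z (t : ℂ) (by simpa [hset] using ht)).restrictScalars
      (𝕜 := ℝ)
    have h2 : AnalyticAt ℝ (fun t : ℝ => (t : ℂ)) t := Complex.ofRealCLM.analyticAt t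
    exact (Complex.imCLM.analyticAt _).comp (h1.comp h2)
  have := han.eqOn_zero_of_preconnected_of_eventuallyEq_zero hpre (z₀ := 0)
    (by simpa using h0) h
  simpa using this (show ℓ 1 ∈ s by simpa [ℓ] using hz)

/-- Holomorphic dependence of integrals on a parameter. -/
theorem differentiableAt_intervalIntegral [ProperSpace E] {F : E → ℝ → ℂ} {z₀ : E} {a b R : ℝ}
    (hR : 0 < R)
    (hcont : ContinuousOn (Function.uncurry F) (Metric.closedBall z₀ R ×ˢ Set.uIcc a b))
    (hd : ∀ θ ∈ Set.uIcc a b, DifferentiableOn ℂ (fun z => F z θ) (Metric.ball z₀ R)) :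
    DifferentiableAt ℂ (fun z => ∫ θ in a..b, F z θ) z₀ := by
  have hK : IsCompact (Metric.closedBall z₀ R ×ˢ Set.uIcc a b) :=
    (isCompact_closedBall z₀ R).prod isCompact_uIcc
  obtain ⟨M, hM⟩ := hK.exists_bound_of_continuousOn hcont
  have hslice : ∀ z ∈ Metric.closedBall z₀ R, ContinuousOn (F z) (Set.uIcc a b) := fun z hz =>
    hcont.comp (by fun_prop : ContinuousOn (fun θ => (z, θ)) _) fun θ hθ => ⟨hz, hθ⟩
  have hsub : Metric.ball z₀ R ⊆ Metric.closedBall z₀ R := Metric.ball_subset_closedBall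
  -- The derivative in the parameter depends continuously on the integration variable, by Cauchy's
  -- estimate and uniform continuity.
  have hF' : ContinuousOn (fun θ => fderiv ℂ (fun z => F z θ) z₀) (Set.uIcc a b) := by
    have huc := hK.uniformContinuousOn_of_continuous hcont
    rw [Metric.uniformContinuousOn_iff] at huc
    rw [Metric.continuousOn_iff]
    intro θ hθ ε hε
    obtain ⟨δ, hδ, h⟩ := huc (ε * R / 4) (by positivity)
    refine ⟨δ, hδ, fun θ' hθ' hlt => ?_⟩
    have hz₀ : Metric.ball z₀ R ∈ 𝓝 z₀ := Metric.ball_mem_nhds _ hR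
    rw [dist_eq_norm, ← fderiv_sub ((hd θ' hθ').differentiableAt hz₀)
      ((hd θ hθ).differentiableAt hz₀)]
    have := norm_fderiv_le_of_bounded (M := ε * R / 4) hR ((hd θ' hθ').sub (hd θ hθ))
      fun w hw => by
        have := h (w, θ') ⟨hsub hw, hθ'⟩ (w, θ) ⟨hsub hw, hθ⟩ (by
          rw [Prod.dist_eq]
          simpa using hlt)
        rw [dist_eq_norm] at this
        exact this.le
    refine this.trans_lt ?_
    have : 2 * (ε * R / 4) / R = ε / 2 := by field_simp; ring
    linarith
  have hball : Metric.ball z₀ (R / 2) ∈ 𝓝 z₀ := Metric.ball_mem_nhds _ (half_pos hR)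
  have hsub' : Metric.ball z₀ (R / 2) ⊆ Metric.closedBall z₀ R :=
    (Metric.ball_subset_ball (by linarith)).trans hsub
  refine (intervalIntegral.hasFDerivAt_integral_of_dominated_loc_of_lip
    (F' := fun θ => fderiv ℂ (fun z => F z θ) z₀) (bound := fun _ => 2 * M / (R / 2))
    hball ?_ ?_ ((hF'.mono Set.uIoc_subset_uIcc).aestronglyMeasurable measurableSet_uIoc)
    ?_ (by simp) ?_).2.differentiableAt
  · filter_upwards [hball] with z hz
    exact ((hslice z (hsub' hz)).mono Set.uIoc_subset_uIcc).aestronglyMeasurable measurableSet_uIoc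
  · exact (hslice z₀ (hsub (Metric.mem_ball_self hR))).intervalIntegrable
  · refine Eventually.of_forall fun θ hθ => LipschitzOnWith.of_dist_le_mul fun x hx y hy => ?_
    have hθ' := Set.uIoc_subset_uIcc hθ
    have h2 : 2 * (R / 2) = R := by ring
    have hle := dist_le_of_bounded (f := fun z => F z θ) (M := M) (half_pos hR)
      (by rw [h2]; exact hd θ hθ') (fun w hw => hM (w, θ) ⟨hsub (by rwa [h2] at hw), hθ'⟩) hx hy
    refine hle.trans ?_
    gcongr
    exact le_abs_self _
  · refine Eventually.of_forall fun θ hθ => ?_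
    exact ((hd θ (Set.uIoc_subset_uIcc hθ)).differentiableAt
      (Metric.ball_mem_nhds _ hR)).hasFDerivAt

end Holomorphic

/-! ### Division by a linear form -/

section Division

variable {E : Type*} [NormedAddCommGroup E] [NormedSpace ℂ E]

/-- The quotient of a function `h` by a linear form `L`, as a Cauchy integral over a circle of
radius `δ` in the direction of a vector `v` with `L v = 1`. -/
def divForm (L : E →L[ℂ] ℂ) (v : E) (δ : ℝ) (h : E → ℂ) (z : E) : ℂ :=
  ∫ θ in (0 : ℝ)..2 * Real.pi,
    ((2 * Real.pi : ℝ) : ℂ)⁻¹ * (h (z + circleMap 0 δ θ • v) * (circleMap 0 δ θ + L z)⁻¹)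

variable {L : E →L[ℂ] ℂ} {v : E} {δ ρ ρ' : ℝ} {h : E → ℂ}

theorem half_le_norm_circleMap_add (hδ : 0 < δ) {a : ℂ} (ha : ‖a‖ ≤ δ / 2) (θ : ℝ) :
    δ / 2 ≤ ‖circleMap 0 δ θ + a‖ := by
  have h1 : ‖circleMap 0 δ θ‖ = δ := by rw [norm_circleMap_zero, abs_of_pos hδ]
  have h2 := norm_sub_le_norm_add (circleMap 0 δ θ) a
  linarith

theorem continuousOn_divForm_integrand (hδ : 0 < δ)
    (hL : ∀ z ∈ Metric.ball (0 : E) ρ', ‖L z‖ ≤ δ / 2)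
    (hv : ∀ z ∈ Metric.ball (0 : E) ρ', ∀ t : ℂ, ‖t‖ ≤ δ → z + t • v ∈ Metric.ball (0 : E) ρ)
    (hh : ContinuousOn h (Metric.ball 0 ρ)) :
    ContinuousOn (Function.uncurry fun (z : E) (θ : ℝ) =>
      ((2 * Real.pi : ℝ) : ℂ)⁻¹ * (h (z + circleMap 0 δ θ • v) * (circleMap 0 δ θ + L z)⁻¹))
      (Metric.ball 0 ρ' ×ˢ Set.univ) := by
  have hc : Continuous fun p : E × ℝ => circleMap 0 δ p.2 :=
    (continuous_circleMap 0 δ).comp continuous_snd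
  refine ContinuousOn.mul continuousOn_const (ContinuousOn.mul ?_ (ContinuousOn.inv₀ ?_ ?_))
  · refine hh.comp (t := Metric.ball 0 ρ) (Continuous.continuousOn (by fun_prop)) ?_
    rintro ⟨z, θ⟩ ⟨hz, -⟩
    exact hv z hz _ (by rw [norm_circleMap_zero, abs_of_pos hδ])
  · exact Continuous.continuousOn (by fun_prop)
  · rintro ⟨z, θ⟩ ⟨hz, -⟩
    exact norm_pos_iff.1 ((half_pos hδ).trans_le (half_le_norm_circleMap_add hδ (hL z hz) θ))

theorem differentiableOn_divForm [ProperSpace E] (hδ : 0 < δ)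
    (hL : ∀ z ∈ Metric.ball (0 : E) ρ', ‖L z‖ ≤ δ / 2)
    (hv : ∀ z ∈ Metric.ball (0 : E) ρ', ∀ t : ℂ, ‖t‖ ≤ δ → z + t • v ∈ Metric.ball (0 : E) ρ)
    (hh : DifferentiableOn ℂ h (Metric.ball 0 ρ)) :
    DifferentiableOn ℂ (divForm L v δ h) (Metric.ball 0 ρ') := by
  intro z₀ hz₀
  obtain ⟨R, hR, hRs⟩ := Metric.nhds_basis_closedBall.mem_iff.1
    (Metric.isOpen_ball.mem_nhds hz₀)
  refine (differentiableAt_intervalIntegral hR ?_ fun θ _ => ?_).differentiableWithinAt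
  · exact (continuousOn_divForm_integrand hδ hL hv hh.continuousOn).mono
      (Set.prod_mono hRs (Set.subset_univ _))
  · intro z hz
    have hz' := hRs (Metric.ball_subset_closedBall hz)
    have h1 : DifferentiableAt ℂ h (z + circleMap 0 δ θ • v) :=
      hh.differentiableAt (Metric.isOpen_ball.mem_nhds
        (hv z hz' _ (by rw [norm_circleMap_zero, abs_of_pos hδ])))
    have h2 : DifferentiableAt ℂ (fun z => h (z + circleMap 0 δ θ • v)) z :=
      DifferentiableAt.comp z h1 (by fun_prop)
    have h3 : DifferentiableAt ℂ (fun z => (circleMap 0 δ θ + L z)⁻¹) z := by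
      refine DifferentiableAt.inv (by fun_prop) ?_
      exact norm_pos_iff.1 ((half_pos hδ).trans_le (half_le_norm_circleMap_add hδ (hL z hz') θ))
    exact ((h2.mul h3).const_mul _).differentiableWithinAt

theorem norm_divForm_sub_le (hδ : 0 < δ)
    (hL : ∀ z ∈ Metric.ball (0 : E) ρ', ‖L z‖ ≤ δ / 2)
    (hv : ∀ z ∈ Metric.ball (0 : E) ρ', ∀ t : ℂ, ‖t‖ ≤ δ → z + t • v ∈ Metric.ball (0 : E) ρ)
    {h' : E → ℂ} (hh : ContinuousOn h (Metric.ball 0 ρ)) (hh' : ContinuousOn h' (Metric.ball 0 ρ))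
    {ε : ℝ} (hε : ∀ z ∈ Metric.ball 0 ρ, ‖h z - h' z‖ ≤ ε) {z : E} (hz : z ∈ Metric.ball 0 ρ') :
    ‖divForm L v δ h z - divForm L v δ h' z‖ ≤ 2 / δ * ε := by
  have hint : ∀ {g : E → ℂ}, ContinuousOn g (Metric.ball 0 ρ) → IntervalIntegrable
      (fun θ => ((2 * Real.pi : ℝ) : ℂ)⁻¹ *
        (g (z + circleMap 0 δ θ • v) * (circleMap 0 δ θ + L z)⁻¹))
      MeasureTheory.volume 0 (2 * Real.pi) := fun hg =>
    ((continuousOn_divForm_integrand hδ hL hv hg).comp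
      (by fun_prop : ContinuousOn (fun θ : ℝ => (z, θ)) _)
      fun θ _ => ⟨hz, Set.mem_univ θ⟩).intervalIntegrable
  have hπ := Real.pi_pos
  rw [divForm, divForm, ← intervalIntegral.integral_sub (hint hh) (hint hh')]
  have := intervalIntegral.norm_integral_le_of_norm_le_const (a := 0) (b := 2 * Real.pi)
    (C := (2 * Real.pi)⁻¹ * (ε * (δ / 2)⁻¹)) (f := fun θ =>
      ((2 * Real.pi : ℝ) : ℂ)⁻¹ * (h (z + circleMap 0 δ θ • v) * (circleMap 0 δ θ + L z)⁻¹) -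
      ((2 * Real.pi : ℝ) : ℂ)⁻¹ * (h' (z + circleMap 0 δ θ • v) * (circleMap 0 δ θ + L z)⁻¹))
    fun θ _ => by
      have hmem := hv z hz (circleMap 0 δ θ) (by rw [norm_circleMap_zero, abs_of_pos hδ])
      have h1 := half_le_norm_circleMap_add hδ (hL z hz) θ
      have h2 : ‖((2 * Real.pi : ℝ) : ℂ)⁻¹‖ = (2 * Real.pi)⁻¹ := by
        rw [norm_inv, Complex.norm_real, Real.norm_of_nonneg (by positivity)]
      rw [← mul_sub, ← sub_mul, norm_mul, norm_mul, h2, norm_inv]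
      gcongr
      · exact (norm_nonneg _).trans (hε _ hmem)
      · exact hε _ hmem
  refine this.trans_eq ?_
  rw [sub_zero, abs_of_pos (by positivity)]
  field_simp

/-- Since `L z / (t (t + L z)) = 1 / t - 1 / (t + L z)`, Cauchy's formula gives
`L z * divForm L v δ h z = h z - h (z - L z • v)`, and the last point lies in the kernel of `L`. -/
theorem mul_divForm (hδ : 0 < δ) (hLv : L v = 1)
    (hL : ∀ z ∈ Metric.ball (0 : E) ρ', ‖L z‖ ≤ δ / 2)
    (hv : ∀ z ∈ Metric.ball (0 : E) ρ', ∀ t : ℂ, ‖t‖ ≤ δ → z + t • v ∈ Metric.ball (0 : E) ρ)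
    (hh : DifferentiableOn ℂ h (Metric.ball 0 ρ))
    (h0 : ∀ z ∈ Metric.ball (0 : E) ρ, L z = 0 → h z = 0) {z : E} (hz : z ∈ Metric.ball 0 ρ') :
    L z * divForm L v δ h z = h z := by
  have hLz : ‖L z‖ ≤ δ / 2 := hL z hz
  have hg : DifferentiableOn ℂ (fun t : ℂ => h (z + t • v)) (Metric.closedBall 0 δ) := by
    intro t ht
    have h1 : DifferentiableAt ℂ h (z + t • v) := hh.differentiableAt
      (Metric.isOpen_ball.mem_nhds (hv z hz t (by simpa using ht)))
    exact (DifferentiableAt.comp t h1 (by fun_prop)).differentiableWithinAt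
  have hcircle : ContinuousOn (fun t : ℂ => h (z + t • v)) (Metric.sphere 0 δ) :=
    hg.continuousOn.mono Metric.sphere_subset_closedBall
  have hsphere : ∀ a : ℂ, ‖a‖ < δ →
      CircleIntegrable (fun t : ℂ => (t - a)⁻¹ • h (z + t • v)) 0 δ := fun a ha => by
    refine ContinuousOn.circleIntegrable hδ.le
      (ContinuousOn.fun_smul (ContinuousOn.fun_inv₀ ?_ ?_) hcircle)
    · fun_prop
    · intro t ht h0
      rw [sub_eq_zero.1 h0, mem_sphere_zero_iff_norm] at ht
      linarith
  have hzero : h (z + (-L z) • v) = 0 := by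
    refine h0 _ (hv z hz _ (by rw [norm_neg]; linarith)) ?_
    simp [hLv]
  have e1 := hg.circleIntegral_sub_inv_smul (w := 0) (by simpa using hδ)
  have e2 := hg.circleIntegral_sub_inv_smul (w := -L z) (by simp; linarith)
  have e3 : L z * divForm L v δ h z = (2 * Real.pi * Complex.I)⁻¹ *
      ∮ t in C(0, δ), ((t - 0)⁻¹ • h (z + t • v) - (t - -L z)⁻¹ • h (z + t • v)) := by
    rw [divForm, circleIntegral, ← intervalIntegral.integral_const_mul,
      ← intervalIntegral.integral_const_mul]
    refine intervalIntegral.integral_congr fun θ _ => ?_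
    have h1 : circleMap 0 δ θ ≠ 0 := circleMap_ne_center hδ.ne'
    have h2 : circleMap 0 δ θ + L z ≠ 0 :=
      norm_pos_iff.1 ((half_pos hδ).trans_le (half_le_norm_circleMap_add hδ hLz θ))
    have h3 : (Real.pi : ℂ) ≠ 0 := by exact_mod_cast Real.pi_ne_zero
    simp only [deriv_circleMap, sub_zero, sub_neg_eq_add, smul_eq_mul]
    push_cast
    field_simp
    ring
  rw [e3, circleIntegral.integral_sub (hsphere 0 (by simpa using hδ))
    (hsphere _ (by rw [norm_neg]; linarith)), e1, e2, hzero]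
  have h3 : (Real.pi : ℂ) ≠ 0 := by exact_mod_cast Real.pi_ne_zero
  simp only [zero_smul, add_zero, smul_eq_mul, mul_zero, sub_zero]
  field_simp

/-- Division by a nonzero linear form is a bounded operator from holomorphic functions on a ball
that vanish on the kernel of the form to holomorphic functions on a smaller ball. -/
theorem exists_division [ProperSpace E] (hL0 : L ≠ 0) (hρ : 0 < ρ) :
    ∃ (D : (E → ℂ) → E → ℂ) (ρ' C : ℝ), 0 < ρ' ∧ ρ' ≤ ρ ∧ 0 < C ∧
      (∀ h, DifferentiableOn ℂ h (Metric.ball 0 ρ) →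
        DifferentiableOn ℂ (D h) (Metric.ball 0 ρ')) ∧
      (∀ h, DifferentiableOn ℂ h (Metric.ball 0 ρ) →
        (∀ z ∈ Metric.ball (0 : E) ρ, L z = 0 → h z = 0) →
        ∀ z ∈ Metric.ball (0 : E) ρ', L z * D h z = h z) ∧
      (∀ h h' ε, DifferentiableOn ℂ h (Metric.ball 0 ρ) →
        DifferentiableOn ℂ h' (Metric.ball 0 ρ) →
        (∀ z ∈ Metric.ball (0 : E) ρ, ‖h z - h' z‖ ≤ ε) →
        ∀ z ∈ Metric.ball (0 : E) ρ', ‖D h z - D h' z‖ ≤ C * ε) := by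
  obtain ⟨w, hw⟩ : ∃ w, L w ≠ 0 := by
    by_contra! hcon
    exact hL0 (ContinuousLinearMap.ext hcon)
  let v := (L w)⁻¹ • w
  have hLv : L v = 1 := by simp [v, hw]
  have hv1 : 0 < ‖v‖ + 1 := by positivity
  let δ := ρ / (2 * (‖v‖ + 1))
  have hδ : 0 < δ := by positivity
  let ρ' := min (ρ / 2) (δ / (2 * (‖L‖ + 1)))
  have hL1 : 0 < ‖L‖ + 1 := by positivity
  have hρ' : 0 < ρ' := lt_min (by positivity) (by positivity)
  have hL : ∀ z ∈ Metric.ball (0 : E) ρ', ‖L z‖ ≤ δ / 2 := fun z hz => by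
    rw [mem_ball_zero_iff] at hz
    calc ‖L z‖ ≤ ‖L‖ * ‖z‖ := L.le_opNorm z
      _ ≤ (‖L‖ + 1) * (δ / (2 * (‖L‖ + 1))) := by
        gcongr
        · linarith
        · exact hz.le.trans (min_le_right _ _)
      _ = δ / 2 := by field_simp
  have hv : ∀ z ∈ Metric.ball (0 : E) ρ', ∀ t : ℂ, ‖t‖ ≤ δ →
      z + t • v ∈ Metric.ball (0 : E) ρ := fun z hz t ht => by
    rw [mem_ball_zero_iff] at hz ⊢
    calc ‖z + t • v‖ ≤ ‖z‖ + ‖t‖ * ‖v‖ := (norm_add_le _ _).trans_eq (by rw [norm_smul])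
      _ ≤ ‖z‖ + δ * (‖v‖ + 1) := by gcongr; linarith
      _ = ‖z‖ + ρ / 2 := by simp only [δ]; field_simp
      _ < ρ / 2 + ρ / 2 := by gcongr; exact hz.trans_le (min_le_left _ _)
      _ = ρ := by ring
  exact ⟨divForm L v δ, ρ', 2 / δ, hρ', (min_le_left _ _).trans (by linarith), by positivity,
    fun h hh => differentiableOn_divForm hδ hL hv hh,
    fun h hh h0 z hz => mul_divForm hδ hLv hL hv hh h0 hz,
    fun h h' ε hh hh' hε z hz =>
      norm_divForm_sub_le hδ hL hv hh.continuousOn hh'.continuousOn hε hz⟩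

end Division

/-! ### Generic germs -/

section Generic

variable {E : Type*} [AddCommGroup E] [Module ℂ E] [TopologicalSpace E]

theorem eventually_genericNhds_ne_zero {L : E →L[ℂ] ℂ} (hL : L ≠ 0) :
    ∀ᶠ z in genericNhds E, L z ≠ 0 :=
  mem_inf_of_right (mem_iInf_of_mem L (mem_iInf_of_mem hL (mem_principal_self _)))

theorem genericNhds_le_nhds : genericNhds E ≤ 𝓝 0 := inf_le_left

variable [IsTopologicalAddGroup E] [ContinuousSMul ℂ E]

theorem dense_ne_zero {L : E →L[ℂ] ℂ} (hL : L ≠ 0) : Dense {z | L z ≠ 0} := by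
  obtain ⟨w, hw⟩ : ∃ w, L w ≠ 0 := by
    by_contra! hcon
    exact hL (ContinuousLinearMap.ext hcon)
  intro z
  by_cases hz : L z = 0
  · have h1 : Tendsto (fun t : ℂ => z + t • w) (𝓝[≠] 0) (𝓝 z) := by
      have h : Continuous fun t : ℂ => z + t • w := by fun_prop
      simpa using (h.tendsto 0).mono_left nhdsWithin_le_nhds
    refine mem_closure_of_tendsto h1 ?_
    filter_upwards [self_mem_nhdsWithin] with t ht
    simpa [hz, hw] using ht
  · exact subset_closure hz

theorem exists_dense_of_mem_genericNhds {s : Set E} (hs : s ∈ genericNhds E) :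
    ∃ u ∈ 𝓝 (0 : E), ∃ t : Set E, IsOpen t ∧ Dense t ∧ u ∩ t ⊆ s := by
  obtain ⟨u, hu, t, ht, rfl⟩ := mem_inf_iff.1 hs
  let G : Filter E :=
    { sets := {t | ∃ t' ⊆ t, IsOpen t' ∧ Dense t'}
      univ_sets := ⟨Set.univ, le_rfl, isOpen_univ, dense_univ⟩
      sets_of_superset := by
        rintro x y ⟨t', h1, h2⟩ hxy
        exact ⟨t', h1.trans hxy, h2⟩
      inter_sets := by
        rintro x y ⟨t', h1, h2, h3⟩ ⟨t'', h4, h5, h6⟩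
        exact ⟨t' ∩ t'', Set.inter_subset_inter h1 h4, h2.inter h5,
          h3.inter_of_isOpen_left h6 h2⟩ }
  have hG : G ≤ ⨅ (L : E →L[ℂ] ℂ) (_ : L ≠ 0), 𝓟 {z | L z ≠ 0} := by
    refine le_iInf₂ fun L hL => le_principal_iff.2 ?_
    exact ⟨{z | L z ≠ 0}, le_rfl, isOpen_ne.preimage L.continuous, dense_ne_zero hL⟩
  obtain ⟨t', h1, h2, h3⟩ := hG ht
  exact ⟨u, hu, t', h2, h3, Set.inter_subset_inter_right u h1⟩

/-- Functions that are continuous near zero and have the same generic germ agree near zero. -/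
theorem eventuallyEq_nhds_of_generic {f g : E → ℂ} {U : Set E} (hU : U ∈ 𝓝 0)
    (hf : ContinuousOn f U) (hg : ContinuousOn g U) (h : f =ᶠ[genericNhds E] g) :
    f =ᶠ[𝓝 0] g := by
  obtain ⟨u, hu, t, hto, htd, hut⟩ := exists_dense_of_mem_genericNhds h
  obtain ⟨W, hWsub, hWo, hW0⟩ := mem_nhds_iff.1 (inter_mem hu hU)
  have heq : Set.EqOn f g (W ∩ t) := fun z hz => hut ⟨(hWsub hz.1).1, hz.2⟩
  have hWU : W ⊆ U := fun z hz => (hWsub hz).2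
  filter_upwards [hWo.mem_nhds hW0] with z hz
  exact heq.of_subset_closure (hf.mono hWU) (hg.mono hWU) Set.inter_subset_left
    (htd.open_subset_closure_inter hWo) hz

end Generic

/-! ### Balls of inner products -/

section QBall

variable {d : ℕ}

/-- The norm of an inner product, transported to `ℂᵈ`, has open convex balls and dominates the
standard norm. -/
theorem isOpen_convex_bound_of_core {V : Type*} [AddCommGroup V] [Module ℂ V]
    (Q : InnerProductSpace.Core ℂ V) (e : (Fin d → ℂ) ≃ₗ[ℂ] V) :
    (∀ r, IsOpen {z | Real.sqrt (Q.inner (e z) (e z)).re < r}) ∧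
    (∀ r, Convex ℝ {z | Real.sqrt (Q.inner (e z) (e z)).re < r}) ∧
    ∃ C, 0 < C ∧ ∀ z, ‖z‖ ≤ C * Real.sqrt (Q.inner (e z) (e z)).re := by
  let : NormedAddCommGroup V := Q.toNormedAddCommGroup
  let : NormedSpace ℂ V := InnerProductSpace.Core.toNormedSpace
  have : FiniteDimensional ℂ V := e.finiteDimensional
  let e' := e.toContinuousLinearEquiv
  have hset : ∀ r, {z | Real.sqrt (Q.inner (e z) (e z)).re < r} = e ⁻¹' Metric.ball 0 r := by
    intro r
    ext z
    rw [Set.mem_preimage, mem_ball_zero_iff]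
    rfl
  refine ⟨fun r => ?_, fun r => ?_, ?_⟩
  · rw [hset]
    exact Metric.isOpen_ball.preimage e'.continuous
  · rw [hset]
    exact (convex_ball (0 : V) r).linear_preimage (e.toLinearMap.restrictScalars ℝ)
  · refine ⟨‖(e'.symm : V →L[ℂ] (Fin d → ℂ))‖ + 1, by positivity, fun z => ?_⟩
    have h1 := (e'.symm : V →L[ℂ] (Fin d → ℂ)).le_opNorm (e z)
    have h2 : (e'.symm : V →L[ℂ] (Fin d → ℂ)) (e z) = z := e'.symm_apply_apply z
    rw [h2] at h1
    refine h1.trans ?_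
    change _ ≤ _ * ‖e z‖
    gcongr
    linarith

variable (Q : InnerProductSpace.Core ℂ (Fin d → ℂ))

theorem isOpen_qball (r : ℝ) : IsOpen (qball Q r) :=
  (isOpen_convex_bound_of_core Q (LinearEquiv.refl ℂ _)).1 r

theorem convex_qball (r : ℝ) : Convex ℝ (qball Q r) :=
  (isOpen_convex_bound_of_core Q (LinearEquiv.refl ℂ _)).2.1 r

theorem zero_mem_qball {r : ℝ} (hr : 0 < r) : (0 : Fin d → ℂ) ∈ qball Q r := by
  have h : Q.inner 0 0 = 0 := by
    have := Q.smul_left 0 0 0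
    simpa using this
  change Real.sqrt (Q.inner 0 0).re < r
  simpa [h] using hr

theorem qball_mem_nhds {r : ℝ} (hr : 0 < r) : qball Q r ∈ 𝓝 (0 : Fin d → ℂ) :=
  (isOpen_qball Q r).mem_nhds (zero_mem_qball Q hr)

/-- Small balls of an inner product are contained in small balls of the standard norm. -/
theorem exists_qball_subset {ε : ℝ} (hε : 0 < ε) :
    ∃ r₀ > 0, ∀ r ≤ r₀, qball Q r ⊆ Metric.ball 0 ε := by
  obtain ⟨C, hC, h⟩ := (isOpen_convex_bound_of_core Q (LinearEquiv.refl ℂ _)).2.2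
  refine ⟨ε / C, by positivity, fun r hr z hz => ?_⟩
  rw [mem_ball_zero_iff]
  refine (h z).trans_lt ?_
  have hz' : Real.sqrt (Q.inner z z).re < ε / C := lt_of_lt_of_le hz hr
  rw [lt_div_iff₀ hC, mul_comm] at hz'
  exact hz'

theorem exists_nat_qball_subset {ε : ℝ} (hε : 0 < ε) :
    ∃ N : ℕ, ∀ n ≥ N, qball Q (1 / ((n : ℝ) + 1)) ⊆ Metric.ball 0 ε := by
  obtain ⟨r₀, hr₀, h⟩ := exists_qball_subset Q hε
  obtain ⟨N, hN⟩ := exists_nat_one_div_lt hr₀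
  refine ⟨N, fun n hn => h _ (le_trans ?_ hN.le)⟩
  gcongr

end QBall

/-! ### Bounded holomorphic functions -/

section BHol

variable {d : ℕ} {Q : InnerProductSpace.Core ℂ (Fin d → ℂ)} {r : ℝ}

theorem zeroExt_apply {B : Set (Fin d → ℂ)} (f : B →ᵇ ℂ) {z : Fin d → ℂ} (hz : z ∈ B) :
    zeroExt B f z = f ⟨z, hz⟩ :=
  Subtype.val_injective.extend_apply f (0 : (Fin d → ℂ) → ℂ) ⟨z, hz⟩

theorem BHol.differentiableOn (f : BHol Q r) :
    DifferentiableOn ℂ (zeroExt (qball Q r) f) (qball Q r) := f.2.1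

theorem BHol.im_eq_zero (f : BHol Q r) {z : Fin d → ℂ} (hz : z ∈ qball Q r)
    (hre : ∀ i, (z i).im = 0) : (zeroExt (qball Q r) f z).im = 0 := by
  rw [zeroExt_apply _ hz]
  exact f.2.2 ⟨z, hz⟩ hre

theorem BHol.norm_apply_le (f : BHol Q r) {z : Fin d → ℂ} (hz : z ∈ qball Q r) :
    ‖zeroExt (qball Q r) f z‖ ≤ ‖f‖ := by
  rw [zeroExt_apply _ hz]
  exact BoundedContinuousFunction.norm_coe_le_norm (f : qball Q r →ᵇ ℂ) ⟨z, hz⟩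

theorem BHol.norm_le (f : BHol Q r) {M : ℝ} (hM : 0 ≤ M)
    (h : ∀ z ∈ qball Q r, ‖zeroExt (qball Q r) f z‖ ≤ M) : ‖f‖ ≤ M := by
  refine (BoundedContinuousFunction.norm_le (f := (f : qball Q r →ᵇ ℂ)) hM).2 fun z => ?_
  have := h z.1 z.2
  rwa [zeroExt_apply _ z.2] at this

theorem BHol.ext {f g : BHol Q r}
    (h : ∀ z ∈ qball Q r, zeroExt (qball Q r) f z = zeroExt (qball Q r) g z) : f = g := by
  refine Subtype.ext (BoundedContinuousFunction.ext fun z => ?_)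
  have := h z.1 z.2
  rwa [zeroExt_apply _ z.2, zeroExt_apply _ z.2] at this

theorem BHol.exists_of_bounded {h : (Fin d → ℂ) → ℂ} (hd : DifferentiableOn ℂ h (qball Q r))
    {M : ℝ} (hM : ∀ z ∈ qball Q r, ‖h z‖ ≤ M)
    (hre : ∀ z ∈ qball Q r, (∀ i, (z i).im = 0) → (h z).im = 0) :
    ∃ f : BHol Q r, ∀ z ∈ qball Q r, zeroExt (qball Q r) f z = h z := by
  let f : qball Q r →ᵇ ℂ := BoundedContinuousFunction.ofNormedAddCommGroup
    (fun z : qball Q r => h z) (continuousOn_iff_continuous_domRestrict.1 hd.continuousOn) M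
    fun z => hM z.1 z.2
  have hf : ∀ z ∈ qball Q r, zeroExt (qball Q r) f z = h z := fun z hz => zeroExt_apply f hz
  exact ⟨⟨f, hd.congr hf, fun z hz => hre z.1 z.2 hz⟩, hf⟩

theorem BHol.isClosed : IsClosed (BHol Q r : Set (qball Q r →ᵇ ℂ)) := by
  refine IsSeqClosed.isClosed fun f g hf hfg => ⟨?_, fun z hz => ?_⟩
  · refine differentiableOn_of_tendstoUniformlyOn (isOpen_qball Q r) (fun n => (hf n).1) ?_
    have := BoundedContinuousFunction.tendsto_iff_tendstoUniformly.1 hfg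
    rw [Metric.tendstoUniformlyOn_iff]
    intro ε hε
    filter_upwards [Metric.tendstoUniformly_iff.1 this ε hε] with n hn z hz
    rw [zeroExt_apply _ hz, zeroExt_apply _ hz]
    exact hn ⟨z, hz⟩
  · have h1 : Tendsto (fun n => (f n z).im) atTop (𝓝 (g z).im) :=
      (Complex.continuous_im.tendsto _).comp
        (((BoundedContinuousFunction.lipschitz_eval_const z).continuous.tendsto g).comp hfg)
    refine tendsto_nhds_unique h1 ?_
    simp only [(hf _).2 z hz]
    exact tendsto_const_nhds

instance : CompleteSpace (BHol Q r) := BHol.isClosed.completeSpace_coe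

/-- A linear map dominated by a linear map that sends the unit ball to a relatively compact set
is compact. -/
theorem isCompactOperator_of_norm_le {X Y Z : Type*} [NormedAddCommGroup X] [NormedSpace ℝ X]
    [NormedAddCommGroup Y] [NormedSpace ℝ Y] [CompleteSpace Y]
    [NormedAddCommGroup Z] [NormedSpace ℝ Z] {b : X →ₗ[ℝ] Y} {T : X →ₗ[ℝ] Z} {C : ℝ}
    (h : ∀ x, ‖b x‖ ≤ C * ‖T x‖) (hT : IsCompact (closure (T '' Metric.closedBall 0 1))) :
    IsCompactOperator b := by
  rw [isCompactOperator_iff_isCompact_closure_image_closedBall b one_pos]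
  refine TotallyBounded.isCompact_of_isClosed ?_ isClosed_closure
  refine TotallyBounded.closure (Metric.totallyBounded_iff.2 fun ε hε => ?_)
  have hC : 0 < |C| + 1 := by positivity
  obtain ⟨t, htsub, htfin, ht⟩ := totallyBounded_iff_subset.1
    (hT.totallyBounded.subset subset_closure) _ (Metric.dist_mem_uniformity (div_pos hε hC))
  choose! g hg hgt using fun z (hz : z ∈ t) => htsub hz
  refine ⟨(fun z => b (g z)) '' t, htfin.image _, ?_⟩
  rintro _ ⟨x, hx, rfl⟩
  have := ht ⟨x, hx, rfl⟩
  simp only [Set.mem_iUnion] at this ⊢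
  obtain ⟨z, hz, hxz⟩ := this
  refine ⟨b (g z), ⟨z, hz, rfl⟩, ?_⟩
  have hxz' : ‖T x - z‖ < ε / (|C| + 1) := by
    have : dist (T x) z < ε / (|C| + 1) := hxz
    rwa [dist_eq_norm] at this
  rw [lt_div_iff₀ hC] at hxz'
  rw [mem_ball_iff_norm, ← map_sub]
  refine (h _).trans_lt ?_
  rw [map_sub, hgt z hz]
  have h1 := le_abs_self C
  nlinarith [norm_nonneg (T x - z)]

/-- Montel's theorem: restricting bounded holomorphic functions to a closed ball inside their
domain is compact. -/
theorem isCompact_closure_restrict {ρ : ℝ} (hρ : 0 < ρ)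
    (hsub : Metric.ball (0 : Fin d → ℂ) (2 * ρ) ⊆ qball Q r) :
    ∃ T : BHol Q r →ₗ[ℝ] (Metric.closedBall (0 : Fin d → ℂ) (ρ / 2) →ᵇ ℂ),
      (∀ f z, T f z = zeroExt (qball Q r) f z) ∧
      IsCompact (closure (T '' Metric.closedBall 0 1)) := by
  have hK : Metric.closedBall (0 : Fin d → ℂ) (ρ / 2) ⊆ Metric.ball 0 ρ :=
    Metric.closedBall_subset_ball (by linarith)
  have hKq : Metric.closedBall (0 : Fin d → ℂ) (ρ / 2) ⊆ qball Q r :=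
    (hK.trans (Metric.ball_subset_ball (by linarith))).trans hsub
  let j : C(Metric.closedBall (0 : Fin d → ℂ) (ρ / 2), qball Q r) :=
    ⟨Set.inclusion hKq, continuous_inclusion hKq⟩
  let T : BHol Q r →ₗ[ℝ] (Metric.closedBall (0 : Fin d → ℂ) (ρ / 2) →ᵇ ℂ) :=
    { toFun := fun f => (f : qball Q r →ᵇ ℂ).compContinuous j
      map_add' := fun _ _ => rfl
      map_smul' := fun _ _ => rfl }
  have hT : ∀ f z, T f z = zeroExt (qball Q r) f z := fun f z =>
    (zeroExt_apply (f : qball Q r →ᵇ ℂ) (hKq z.2)).symm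
  refine ⟨T, hT, ?_⟩
  have hcs : CompactSpace (Metric.closedBall (0 : Fin d → ℂ) (ρ / 2)) :=
    isCompact_iff_compactSpace.1 (isCompact_closedBall _ _)
  refine BoundedContinuousFunction.arzela_ascoli (Metric.closedBall 0 1)
    (isCompact_closedBall _ _) _ ?_ ?_
  · rintro _ z ⟨f, hf, rfl⟩
    rw [mem_closedBall_zero_iff] at hf ⊢
    rw [hT]
    exact (BHol.norm_apply_le f (hKq z.2)).trans hf
  · refine Metric.equicontinuous_of_continuity_modulus (fun t => 2 * 1 / ρ * t) ?_ _ ?_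
    · have : Continuous fun t : ℝ => 2 * 1 / ρ * t := by fun_prop
      simpa using this.tendsto 0
    · rintro x y ⟨_, f, hf, rfl⟩
      rw [mem_closedBall_zero_iff] at hf
      change dist (T f x) (T f y) ≤ _
      rw [hT, hT]
      exact dist_le_of_bounded hρ ((BHol.differentiableOn f).mono hsub)
        (fun w hw => (BHol.norm_apply_le f (hsub hw)).trans hf) (hK x.2) (hK y.2)

/-- Substituting a real linear map into a bounded holomorphic function and multiplying by a real
entire function is a compact operator between spaces of bounded holomorphic functions on balls,
provided that the target ball is small. -/
theorem exists_compact_map {d' : ℕ} (hr : 0 < r) (Q' : InnerProductSpace.Core ℂ (Fin d' → ℂ))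
    (p : (Fin d' → ℂ) →L[ℂ] (Fin d → ℂ)) (hp : ∀ z, (∀ i, (z i).im = 0) → ∀ i, (p z i).im = 0)
    {R : (Fin d' → ℂ) → ℂ} (hR : Differentiable ℂ R)
    (hRre : ∀ z, (∀ i, (z i).im = 0) → (R z).im = 0) :
    ∃ ε > 0, ∀ r', qball Q' r' ⊆ Metric.ball 0 ε →
      ∃ b : BHol Q r →L[ℝ] BHol Q' r', IsCompactOperator b ∧
        ∀ f, ∀ z ∈ qball Q' r',
          zeroExt (qball Q' r') (b f) z = zeroExt (qball Q r) f (p z) * R z := by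
  obtain ⟨ρ₂, hρ₂, hsub₂⟩ := Metric.mem_nhds_iff.1 (qball_mem_nhds Q hr)
  obtain ⟨ρ, rfl⟩ : ∃ ρ, ρ₂ = 2 * ρ := ⟨ρ₂ / 2, by ring⟩
  have hρ : 0 < ρ := by linarith
  obtain ⟨T, hT, hTc⟩ := isCompact_closure_restrict hρ hsub₂
  obtain ⟨M, hM⟩ := (isCompact_closedBall (0 : Fin d' → ℂ) 1).exists_bound_of_continuousOn
    hR.continuous.continuousOn
  have hp1 : 0 < ‖p‖ + 1 := by positivity
  refine ⟨min 1 (ρ / 2 / (‖p‖ + 1)), lt_min one_pos (by positivity), fun r' hr' => ?_⟩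
  have hRM : ∀ z ∈ qball Q' r', ‖R z‖ ≤ M := fun z hz =>
    hM z (Metric.ball_subset_closedBall
      (Metric.ball_subset_ball (min_le_left _ _) (hr' hz)))
  have hpK : ∀ z ∈ qball Q' r', p z ∈ Metric.closedBall (0 : Fin d → ℂ) (ρ / 2) := fun z hz => by
    have h1 := hr' hz
    rw [mem_ball_zero_iff] at h1
    have h2 := (h1.trans_le (min_le_right _ _)).le
    rw [le_div_iff₀ hp1] at h2
    rw [mem_closedBall_zero_iff]
    refine (p.le_opNorm z).trans ?_
    nlinarith [norm_nonneg z]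
  have hpq : ∀ z ∈ qball Q' r', p z ∈ qball Q r := fun z hz =>
    hsub₂ (Metric.closedBall_subset_ball (by linarith) (hpK z hz))
  have hbound : ∀ f : BHol Q r, ∀ z ∈ qball Q' r',
      ‖zeroExt (qball Q r) f (p z) * R z‖ ≤ M * ‖T f‖ := fun f z hz => by
    have h1 : ‖zeroExt (qball Q r) f (p z)‖ ≤ ‖T f‖ := by
      rw [← hT f ⟨p z, hpK z hz⟩]
      exact (T f).norm_coe_le_norm _
    rw [norm_mul, mul_comm]
    exact mul_le_mul (hRM z hz) h1 (norm_nonneg _) ((norm_nonneg _).trans (hRM z hz))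
  have hex : ∀ f : BHol Q r, ∃ g : BHol Q' r', ∀ z ∈ qball Q' r',
      zeroExt (qball Q' r') g z = zeroExt (qball Q r) f (p z) * R z := fun f =>
    BHol.exists_of_bounded
      (((BHol.differentiableOn f).comp p.differentiableOn hpq).mul hR.differentiableOn) (hbound f)
      fun z hz hre => by
        rw [Complex.mul_im, BHol.im_eq_zero f (hpq z hz) (hp z hre), hRre z hre]
        simp
  choose g hg using hex
  let b : BHol Q r →ₗ[ℝ] BHol Q' r' :=
    { toFun := g
      map_add' := fun f f' => BHol.ext fun z hz => by
        have h1 := hg (f + f') z hz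
        have h2 := hg f z hz
        have h3 := hg f' z hz
        simp only [Submodule.coe_add, map_add, Pi.add_apply] at h1 ⊢
        rw [h1, h2, h3, add_mul]
      map_smul' := fun c f => BHol.ext fun z hz => by
        have h1 := hg (c • f) z hz
        have h2 := hg f z hz
        simp only [Submodule.coe_smul, map_smul, Pi.smul_apply, RingHom.id_apply] at h1 ⊢
        rw [h1, h2, smul_mul_assoc] }
  have hM' : ∀ f, ‖b f‖ ≤ |M| * ‖T f‖ := fun f => by
    refine BHol.norm_le _ (by positivity) fun z hz => ?_
    rw [show b f = g f from rfl, hg f z hz]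
    refine (hbound f z hz).trans ?_
    gcongr
    exact le_abs_self M
  have hTf : ∀ f, ‖T f‖ ≤ ‖f‖ := fun f => by
    refine (BoundedContinuousFunction.norm_le (norm_nonneg _)).2 fun z => ?_
    rw [hT]
    exact BHol.norm_apply_le f (hsub₂ (Metric.closedBall_subset_ball (by linarith) z.2))
  refine ⟨b.mkContinuous |M| fun f => (hM' f).trans (by gcongr; exact hTf f), ?_, hg⟩
  exact isCompactOperator_of_norm_le (b := b) hM' hTc

end BHol

/-! ### Products of linear forms -/

section FormProducts

variable {d : ℕ} {𝓛 : Set ((Fin d → ℂ) →L[ℂ] ℂ)} {P R : (Fin d → ℂ) → ℂ}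

/-- The monoid generated by a set of linear forms: all finite products, including the empty one,
of its elements. -/
def formMonoid (𝓛 : Set ((Fin d → ℂ) →L[ℂ] ℂ)) : Submonoid ((Fin d → ℂ) → ℂ) :=
  Submonoid.closure ((fun L : (Fin d → ℂ) →L[ℂ] ℂ => (L : (Fin d → ℂ) → ℂ)) '' 𝓛)

theorem coe_mem_formMonoid {L : (Fin d → ℂ) →L[ℂ] ℂ} (hL : L ∈ 𝓛) :
    (L : (Fin d → ℂ) → ℂ) ∈ formMonoid 𝓛 :=
  Submonoid.subset_closure ⟨L, hL, rfl⟩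

theorem formProducts_subset_formMonoid : formProducts 𝓛 ⊆ formMonoid 𝓛 := by
  rintro _ ⟨m, L, hL, rfl⟩
  have : (fun z => ∏ i, L i z) = ∏ i, (L i : (Fin d → ℂ) → ℂ) := by
    ext z
    simp
  rw [this]
  exact Submonoid.prod_mem _ fun i _ => coe_mem_formMonoid (hL i)

theorem coe_mem_formProducts {L : (Fin d → ℂ) →L[ℂ] ℂ} (hL : L ∈ 𝓛) :
    (L : (Fin d → ℂ) → ℂ) ∈ formProducts 𝓛 :=
  ⟨0, fun _ => L, fun _ => hL, by simp⟩

theorem mul_mem_formProducts (hR : R ∈ formMonoid 𝓛) (hP : P ∈ formProducts 𝓛) :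
    R * P ∈ formProducts 𝓛 := by
  induction hR using Submonoid.closure_induction_left with
  | one => rwa [one_mul]
  | mul_left x hx y _ ih =>
    obtain ⟨L, hL, rfl⟩ := hx
    obtain ⟨m, L', hL', h⟩ := ih
    refine ⟨m + 1, Fin.cons L L', Fin.cases (by simpa using hL) (by simpa using hL'), ?_⟩
    rw [mul_assoc, h]
    ext z
    simp [Fin.prod_univ_succ]

theorem countable_formProducts (h𝓛 : 𝓛.Countable) : (formProducts 𝓛).Countable := by
  have : Countable 𝓛 := h𝓛.to_subtype
  refine (Set.countable_range fun x : Σ m : ℕ, (Fin (m + 1) → 𝓛) =>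
    fun z : Fin d → ℂ => ∏ i, (x.2 i : (Fin d → ℂ) →L[ℂ] ℂ) z).mono ?_
  rintro _ ⟨m, L, hL, rfl⟩
  exact ⟨⟨m, fun i => ⟨L i, hL i⟩⟩, rfl⟩

theorem differentiable_of_mem_formMonoid (hP : P ∈ formMonoid 𝓛) : Differentiable ℂ P := by
  induction hP using Submonoid.closure_induction with
  | mem x hx =>
    obtain ⟨L, -, rfl⟩ := hx
    exact L.differentiable
  | one => exact differentiable_const 1
  | mul x y _ _ hx hy => exact hx.mul hy

theorem im_eq_zero_of_mem_formMonoid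
    (h𝓛 : ∀ L ∈ 𝓛, ∀ z : Fin d → ℂ, (∀ i, (z i).im = 0) → (L z).im = 0)
    (hP : P ∈ formMonoid 𝓛) {z : Fin d → ℂ} (hz : ∀ i, (z i).im = 0) : (P z).im = 0 := by
  induction hP using Submonoid.closure_induction with
  | mem x hx =>
    obtain ⟨L, hL, rfl⟩ := hx
    exact h𝓛 L hL z hz
  | one => simp
  | mul x y _ _ hx hy => simp [hx, hy]

theorem eventually_comp_ne_zero_of_mem_formMonoid {E : Type*} [AddCommGroup E] [Module ℂ E]
    [TopologicalSpace E] (p : E →L[ℂ] (Fin d → ℂ)) (h𝓛 : ∀ L ∈ 𝓛, L.comp p ≠ 0)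
    (hP : P ∈ formMonoid 𝓛) : ∀ᶠ z in genericNhds E, P (p z) ≠ 0 := by
  induction hP using Submonoid.closure_induction with
  | mem x hx =>
    obtain ⟨L, hL, rfl⟩ := hx
    exact eventually_genericNhds_ne_zero (h𝓛 L hL)
  | one => simp
  | mul x y _ _ hx hy =>
    filter_upwards [hx, hy] with z h1 h2
    exact mul_ne_zero h1 h2

theorem eventually_ne_zero_of_mem_formMonoid (h𝓛 : ∀ L ∈ 𝓛, L ≠ 0) (hP : P ∈ formMonoid 𝓛) :
    ∀ᶠ z in genericNhds (Fin d → ℂ), P z ≠ 0 :=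
  eventually_comp_ne_zero_of_mem_formMonoid (ContinuousLinearMap.id ℂ _) h𝓛 hP

end FormProducts

/-! ### Projections -/

/-- The projection of `ℂ^(l+1)` onto the first `k + 1` coordinates. -/
def prLE {k l : ℕ} (h : k ≤ l) : (Fin (l + 1) → ℂ) →L[ℂ] (Fin (k + 1) → ℂ) :=
  ContinuousLinearMap.pi fun i => ContinuousLinearMap.proj (i.castLE (Nat.add_le_add_right h 1))

theorem prLE_proj {k l : ℕ} (h : k ≤ l) (z : ℕ → ℂ) : prLE h (proj l z) = proj k z := rfl

theorem GeneratingFamily.comp_prLE (Λ : GeneratingFamily) {k l : ℕ} (h : k ≤ l)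
    {L : (Fin (k + 1) → ℂ) →L[ℂ] ℂ} (hL : L ∈ Λ.forms k) : L.comp (prLE h) ∈ Λ.forms l := by
  induction l, h using Nat.le_induction with
  | base => exact hL
  | succ l h ih => exact Λ.comp_pr l _ ih

theorem GeneratingFamily.formProducts_comp_prLE (Λ : GeneratingFamily) {k l : ℕ} (h : k ≤ l)
    {P : (Fin (k + 1) → ℂ) → ℂ} (hP : P ∈ formProducts (Λ.forms k)) :
    P ∘ prLE h ∈ formProducts (Λ.forms l) := by
  obtain ⟨m, L, hL, rfl⟩ := hP
  exact ⟨m, fun i => (L i).comp (prLE h), fun i => Λ.comp_prLE h (hL i), rfl⟩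

/-- The section of `proj k` which extends vectors by zero. -/
def projSection (k : ℕ) : (Fin (k + 1) → ℂ) →L[ℂ] (ℕ → ℂ) :=
  ContinuousLinearMap.pi fun j =>
    if h : j < k + 1 then ContinuousLinearMap.proj (⟨j, h⟩ : Fin (k + 1)) else 0

theorem proj_projSection (k : ℕ) (w : Fin (k + 1) → ℂ) : proj k (projSection k w) = w := by
  ext i
  have hi : (i : ℕ) < k + 1 := i.2
  simp only [proj, projSection, ContinuousLinearMap.coe_pi', ContinuousLinearMap.proj_apply,
    dif_pos hi]

/-! ### The compact systems of germs -/

theorem IsCompactSystem.of_iSup_range {ι : Type*} [Nonempty ι] {E : Type*} [AddCommGroup E]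
    [Module ℝ E] {X : ι → Type*} [∀ i, NormedAddCommGroup (X i)] [∀ i, NormedSpace ℝ (X i)]
    {I : ∀ i, X i →ₗ[ℝ] E} (hI : ∀ i, Function.Injective (I i))
    (hsup : ⨆ i, LinearMap.range (I i) = ⊤)
    (hdir : ∀ i j, ∃ l, CompactLE I i l ∧ CompactLE I j l) : IsCompactSystem I := by
  refine ⟨hI, fun y => ?_, hdir⟩
  have hle : ∀ {i l}, CompactLE I i l → LinearMap.range (I i) ≤ LinearMap.range (I l) := by
    rintro i l ⟨b, -, hb⟩ _ ⟨x, rfl⟩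
    exact ⟨b x, hb x⟩
  have hd : Directed (· ≤ ·) fun i => LinearMap.range (I i) := fun i j => by
    obtain ⟨l, h1, h2⟩ := hdir i j
    exact ⟨l, hle h1, hle h2⟩
  have hy : y ∈ ⨆ i, LinearMap.range (I i) := hsup ▸ Submodule.mem_top
  exact (Submodule.mem_iSup_of_directed _ hd).1 hy

theorem iSup_range_eq_top_of_subtype_comp {ι E : Type*} [AddCommGroup E] [Module ℝ E]
    {S : Submodule ℝ E} {X : ι → Type*} [∀ i, AddCommGroup (X i)] [∀ i, Module ℝ (X i)]
    {I : ∀ i, X i →ₗ[ℝ] S} (h : ⨆ i, LinearMap.range (S.subtype.comp (I i)) = S) :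
    ⨆ i, LinearMap.range (I i) = ⊤ := by
  apply Submodule.map_injective_of_injective S.injective_subtype
  rw [Submodule.map_iSup, Submodule.map_subtype_top]
  simpa only [LinearMap.range_comp] using h

/-- A locally convex final topology on a space whose steps carry themselves locally convex final
topologies is determined by the composite maps. -/
theorem lcFinal_sigma {κ : Type*} {ι : κ → Type*} {E : Type*} [AddCommGroup E] [Module ℝ E]
    {Y : κ → Type*} [∀ k, AddCommGroup (Y k)] [∀ k, Module ℝ (Y k)]
    {X : ∀ k, ι k → Type*} [∀ k i, AddCommGroup (X k i)] [∀ k i, Module ℝ (X k i)]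
    [∀ k i, TopologicalSpace (X k i)] (J : ∀ k i, X k i →ₗ[ℝ] Y k) (A : ∀ k, Y k →ₗ[ℝ] E) :
    (@lcFinal κ E _ _ Y _ _ (fun k => lcFinal (J k)) A) =
      lcFinal (fun i : Σ k, ι k => (A i.1).comp (J i.1 i.2)) := by
  let tY : ∀ k, TopologicalSpace (Y k) := fun k => lcFinal (J k)
  refine le_antisymm ?_ ?_
  · refine lcFinal_le (lcFinal_isTopologicalAddGroup _) (lcFinal_continuousSMul _)
      (lcFinal_locallyConvexSpace _) fun k => ?_
    let tE : TopologicalSpace E := lcFinal (fun i : Σ k, ι k => (A i.1).comp (J i.1 i.2))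
    have := lcFinal_isTopologicalAddGroup (fun i : Σ k, ι k => (A i.1).comp (J i.1 i.2))
    have := lcFinal_continuousSMul (fun i : Σ k, ι k => (A i.1).comp (J i.1 i.2))
    have := lcFinal_locallyConvexSpace (fun i : Σ k, ι k => (A i.1).comp (J i.1 i.2))
    exact continuous_lcFinal_dom (A k) fun i =>
      continuous_lcFinal (fun i : Σ k, ι k => (A i.1).comp (J i.1 i.2)) ⟨k, i⟩
  · refine lcFinal_le (lcFinal_isTopologicalAddGroup _) (lcFinal_continuousSMul _)
      (lcFinal_locallyConvexSpace _) fun i => ?_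
    let tE : TopologicalSpace E := lcFinal A
    exact (continuous_lcFinal A i.1).comp (continuous_lcFinal (J i.1) i.2)

/-- A bounded holomorphic function is determined by the generic germ of its composition with a
linear projection. -/
theorem BHol.eq_of_generic {d : ℕ} {Q : InnerProductSpace.Core ℂ (Fin d → ℂ)} {r : ℝ}
    (hr : 0 < r) {E : Type*} [AddCommGroup E] [Module ℂ E] [TopologicalSpace E]
    [IsTopologicalAddGroup E] [ContinuousSMul ℂ E] (p : E →L[ℂ] (Fin d → ℂ))
    (σ : (Fin d → ℂ) →L[ℂ] E) (hσ : ∀ w, p (σ w) = w) {f g : BHol Q r}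
    (h : (fun z => zeroExt (qball Q r) f (p z)) =ᶠ[genericNhds E]
      fun z => zeroExt (qball Q r) g (p z)) : f = g := by
  have hp : Tendsto p (𝓝 0) (𝓝 0) := by simpa using p.continuous.tendsto 0
  have hσ0 : Tendsto σ (𝓝 0) (𝓝 0) := by simpa using σ.continuous.tendsto 0
  have hU : p ⁻¹' qball Q r ∈ 𝓝 (0 : E) := hp (qball_mem_nhds Q hr)
  have hmaps : Set.MapsTo p (p ⁻¹' qball Q r) (qball Q r) := fun _ hz => hz
  have h1 := eventuallyEq_nhds_of_generic hU
    ((BHol.differentiableOn f).continuousOn.comp p.continuous.continuousOn hmaps)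
    ((BHol.differentiableOn g).continuousOn.comp p.continuous.continuousOn hmaps) h
  have h2 := hσ0.eventually h1
  simp only [Function.comp_apply, hσ] at h2
  refine BHol.ext fun z hz => sub_eq_zero.1 ?_
  refine eqOn_zero_of_eventuallyEq_zero (isOpen_qball Q r) (convex_qball Q r)
    (zero_mem_qball Q hr) ((BHol.differentiableOn f).sub (BHol.differentiableOn g)) ?_ hz
  filter_upwards [h2] with w hw
  exact sub_eq_zero.2 hw

theorem one_div_nat_pos (n : ℕ) : (0 : ℝ) < 1 / ((n : ℝ) + 1) := by positivity

theorem isCompactSystem_holo {d : ℕ} (Q : InnerProductSpace.Core ℂ (Fin d → ℂ)) :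
    IsCompactSystem (Holo.step Q) := by
  have hle : ∀ n, ∃ N, ∀ m ≥ N, CompactLE (Holo.step Q) n m := by
    intro n
    obtain ⟨ε, hε, h⟩ := exists_compact_map (Q := Q) (one_div_nat_pos n) Q
      (ContinuousLinearMap.id ℂ _) (fun z hz => hz) (R := 1) (differentiable_const 1)
      (fun z _ => by simp)
    obtain ⟨N, hN⟩ := exists_nat_qball_subset Q hε
    refine ⟨N, fun m hm => ?_⟩
    obtain ⟨b, hb, hbf⟩ := h _ (hN m hm)
    refine ⟨b, hb, fun f => Subtype.ext (Germ.coe_eq.2 ?_)⟩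
    filter_upwards [genericNhds_le_nhds (qball_mem_nhds Q (one_div_nat_pos m))] with z hz
    simp [hbf f z hz]
  refine IsCompactSystem.of_iSup_range (fun n f g hfg => ?_) ?_ fun n m => ?_
  · refine BHol.eq_of_generic (one_div_nat_pos n) (ContinuousLinearMap.id ℂ _)
      (ContinuousLinearMap.id ℂ _) (fun _ => rfl) ?_
    have := Germ.coe_eq.1 (congrArg Subtype.val hfg)
    simpa using this
  · refine iSup_range_eq_top_of_subtype_comp ?_
    rfl
  · obtain ⟨N, hN⟩ := hle n
    obtain ⟨M, hM⟩ := hle m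
    exact ⟨max N M, hN _ (le_max_left _ _), hM _ (le_max_right _ _)⟩

section MeroLim

variable (Q : ∀ k : ℕ, InnerProductSpace.Core ℂ (Fin (k + 1) → ℂ)) (Λ : GeneratingFamily)

/-- The canonical maps of the Banach steps of all the spaces of meromorphic germs in finitely many
variables to the space of meromorphic germs in infinitely many variables. -/
def MeroLim.step (i : Σ k : ℕ, ℕ × formProducts (Λ.forms k)) :
    BHol (Q i.1) (1 / ((i.2.1 : ℝ) + 1)) →ₗ[ℝ] MeroLim Q Λ :=
  (MeroLim.incl Q Λ i.1).comp (Mero.step (Q i.1) (Λ.forms i.1) i.2)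

theorem MeroLim.topology_eq :
    (inferInstance : TopologicalSpace (MeroLim Q Λ)) = lcFinal (MeroLim.step Q Λ) :=
  lcFinal_sigma (fun k => Mero.step (Q k) (Λ.forms k)) (MeroLim.incl Q Λ)

theorem MeroLim.coe_step (k n : ℕ) (P : formProducts (Λ.forms k))
    (f : BHol (Q k) (1 / ((n : ℝ) + 1))) :
    (MeroLim.step Q Λ ⟨k, n, P⟩ f : PGerm (ℕ → ℂ)) =
      ((fun z => zeroExt (qball (Q k) (1 / ((n : ℝ) + 1))) f (proj k z) / P.1 (proj k z) :
        (ℕ → ℂ) → ℂ) : PGerm (ℕ → ℂ)) := rfl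

theorem eventually_proj_ne_zero {k : ℕ} {P : (Fin (k + 1) → ℂ) → ℂ}
    (hP : P ∈ formMonoid (Λ.forms k)) : ∀ᶠ z in genericNhds (ℕ → ℂ), P (proj k z) ≠ 0 :=
  (tendsto_genericNhds (proj k) (proj_surjective k)).eventually
    (eventually_ne_zero_of_mem_formMonoid (Λ.ne_zero k) hP)

/-- A step of meromorphic germs in `k + 1` variables is compactly included in the steps with more
variables, multiples of its denominator and sufficiently small balls. -/
theorem MeroLim.compactLE {k l : ℕ} (h : k ≤ l) (n : ℕ) (P : formProducts (Λ.forms k))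
    {R : (Fin (l + 1) → ℂ) → ℂ} (hR : R ∈ formMonoid (Λ.forms l)) :
    ∃ N, ∀ m ≥ N, ∀ P' : formProducts (Λ.forms l), P'.1 = R * P.1 ∘ prLE h →
      CompactLE (MeroLim.step Q Λ) ⟨k, n, P⟩ ⟨l, m, P'⟩ := by
  obtain ⟨ε, hε, hmap⟩ := exists_compact_map (Q := Q k) (one_div_nat_pos n) (Q l)
    (prLE h) (fun z hz i => hz _) (differentiable_of_mem_formMonoid hR)
    (fun z hz => im_eq_zero_of_mem_formMonoid (Λ.real l) hR hz)
  obtain ⟨N, hN⟩ := exists_nat_qball_subset (Q l) hε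
  refine ⟨N, fun m hm P' hP' => ?_⟩
  obtain ⟨b, hb, hbf⟩ := hmap _ (hN m hm)
  refine ⟨b, hb, fun f => Subtype.ext ?_⟩
  rw [MeroLim.coe_step, MeroLim.coe_step]
  refine Germ.coe_eq.2 ?_
  have hball : ∀ᶠ z in genericNhds (ℕ → ℂ), proj l z ∈ qball (Q l) (1 / ((m : ℝ) + 1)) :=
    (tendsto_genericNhds (proj l) (proj_surjective l)).eventually
      (genericNhds_le_nhds (qball_mem_nhds (Q l) (one_div_nat_pos m)))
  filter_upwards [hball, eventually_proj_ne_zero Λ hR] with z hz hRz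
  rw [hbf f _ hz, hP', Pi.mul_apply, Function.comp_apply, prLE_proj,
    mul_comm (R (proj l z)), mul_div_mul_right _ _ hRz]

theorem MeroLim.iSup_range_step : ⨆ i, LinearMap.range (MeroLim.step Q Λ i) = ⊤ := by
  refine iSup_range_eq_top_of_subtype_comp ?_
  rw [iSup_sigma]
  unfold MeroLim
  refine iSup_congr fun k => ?_
  unfold Mero
  rw [Submodule.map_iSup]
  refine iSup_congr fun i => ?_
  rw [← LinearMap.range_comp]
  rfl

theorem isCompactSystem_meroLim [Nonempty (Σ k : ℕ, ℕ × formProducts (Λ.forms k))] :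
    IsCompactSystem (MeroLim.step Q Λ) := by
  refine IsCompactSystem.of_iSup_range ?_ ?_ ?_
  · rintro ⟨k, n, P⟩ f g hfg
    refine BHol.eq_of_generic (one_div_nat_pos n) (proj k) (projSection k)
      (proj_projSection k) ?_
    have h := congrArg Subtype.val hfg
    rw [MeroLim.coe_step, MeroLim.coe_step] at h
    filter_upwards [Germ.coe_eq.1 h,
      eventually_proj_ne_zero Λ (formProducts_subset_formMonoid P.2)] with z hz hP
    exact (div_left_inj' hP).1 hz
  · exact MeroLim.iSup_range_step Q Λ
  · rintro ⟨k, n, P⟩ ⟨k', n', P'⟩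
    have hP := Λ.formProducts_comp_prLE (le_max_left k k') P.2
    have hP' := Λ.formProducts_comp_prLE (le_max_right k k') P'.2
    obtain ⟨N, hN⟩ := MeroLim.compactLE Q Λ (le_max_left k k') n P
      (formProducts_subset_formMonoid hP')
    obtain ⟨N', hN'⟩ := MeroLim.compactLE Q Λ (le_max_right k k') n' P'
      (formProducts_subset_formMonoid hP)
    refine ⟨⟨max k k', max N N', _, mul_mem_formProducts (formProducts_subset_formMonoid hP') hP⟩,
      hN _ (le_max_left _ _) _ rfl, hN' _ (le_max_right _ _) _ (mul_comm _ _)⟩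

theorem countable_index : Countable (Σ k : ℕ, ℕ × formProducts (Λ.forms k)) := by
  have : ∀ k, Countable (formProducts (Λ.forms k)) := fun k =>
    (countable_formProducts (Λ.countable k)).to_subtype
  infer_instance

end MeroLim

/-! ### Division of convergent sequences -/

section DivisionLimit

variable {d : ℕ} {𝓛 : Set ((Fin d → ℂ) →L[ℂ] ℂ)}

/-- If a linear form `L₁ ≠ 0` vanishes on the kernel of a linear form `L ≠ 0`, then the two forms
are proportional. -/
theorem exists_smul_eq_of_comp_subtype_eq_zero {E : Type*} [NormedAddCommGroup E]
    [NormedSpace ℂ E] {L L₁ : E →L[ℂ] ℂ} (hL : L ≠ 0) (hL₁ : L₁ ≠ 0)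
    (h : L₁.comp (LinearMap.ker L.toLinearMap).subtypeL = 0) : ∃ c : ℂ, c ≠ 0 ∧ L = c • L₁ := by
  obtain ⟨w, hw⟩ : ∃ w, L w ≠ 0 := by
    by_contra! hcon
    exact hL (ContinuousLinearMap.ext hcon)
  have key : ∀ z, L w * L₁ z = L z * L₁ w := fun z => by
    have hker : L w • z - L z • w ∈ LinearMap.ker L.toLinearMap := by
      simp [mul_comm]
    have := congrArg (fun T : (LinearMap.ker L.toLinearMap) →L[ℂ] ℂ => T ⟨_, hker⟩) h
    simpa [sub_eq_zero] using this
  have hw₁ : L₁ w ≠ 0 := fun h0 => hL₁ (ContinuousLinearMap.ext fun z => by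
    have := key z
    rw [h0, mul_zero] at this
    simpa [hw] using this)
  refine ⟨L w / L₁ w, div_ne_zero hw hw₁, ContinuousLinearMap.ext fun z => ?_⟩
  rw [smul_apply, smul_eq_mul, div_mul_eq_mul_div, key, mul_div_cancel_right₀ _ hw₁]

/-- A linear form that is not proportional to any of the forms in `𝓛` is coprime to their products:
if `P' f` is regular and `P L f = h` is holomorphic, with `P` and `P'` products of forms in `𝓛`,
then `h` vanishes on the kernel of `L`. -/
theorem eq_zero_on_ker_of_coprime (h𝓛 : ∀ L ∈ 𝓛, L ≠ 0) {L : (Fin d → ℂ) →L[ℂ] ℂ} (hL : L ≠ 0)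
    (hcop : ∀ L₁ ∈ 𝓛, ∀ c : ℂ, c ≠ 0 → L ≠ c • L₁) {P P' : (Fin d → ℂ) → ℂ}
    (hP : P ∈ formMonoid 𝓛) (hP' : P' ∈ formMonoid 𝓛) {f h k : (Fin d → ℂ) → ℂ} {ρ ρ' : ℝ}
    (hρ : 0 < ρ) (hρ' : 0 < ρ') (hh : DifferentiableOn ℂ h (Metric.ball 0 ρ))
    (hk : ContinuousOn k (Metric.ball 0 ρ'))
    (hPf : (fun z => P z * (L z * f z)) =ᶠ[genericNhds (Fin d → ℂ)] h)
    (hPf' : (fun z => P' z * f z) =ᶠ[genericNhds (Fin d → ℂ)] k) :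
    ∀ z ∈ Metric.ball (0 : Fin d → ℂ) ρ, L z = 0 → h z = 0 := by
  have hPc := (differentiable_of_mem_formMonoid hP).continuous
  have hPc' := (differentiable_of_mem_formMonoid hP').continuous
  have h1 : (fun z => P' z * h z) =ᶠ[genericNhds (Fin d → ℂ)] fun z => P z * (L z * k z) := by
    filter_upwards [hPf, hPf'] with z hz hz'
    rw [← hz, ← hz']
    ring
  have h2 : (fun z => P' z * h z) =ᶠ[𝓝 0] fun z => P z * (L z * k z) := by
    refine eventuallyEq_nhds_of_generic
      (inter_mem (Metric.ball_mem_nhds 0 hρ) (Metric.ball_mem_nhds 0 hρ')) ?_ ?_ h1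
    · exact hPc'.continuousOn.mul (hh.continuousOn.mono Set.inter_subset_left)
    · exact hPc.continuousOn.mul (L.continuous.continuousOn.mul (hk.mono Set.inter_subset_right))
  let K := LinearMap.ker L.toLinearMap
  have hι : Tendsto K.subtypeL (𝓝 0) (𝓝 0) := by simpa using K.subtypeL.continuous.tendsto 0
  have hne : ∀ᶠ z in genericNhds K, P' (K.subtypeL z) ≠ 0 := by
    refine eventually_comp_ne_zero_of_mem_formMonoid K.subtypeL (fun L₁ hL₁ h0 => ?_) hP'
    obtain ⟨c, hc, hLc⟩ := exists_smul_eq_of_comp_subtype_eq_zero hL (h𝓛 L₁ hL₁) h0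
    exact hcop L₁ hL₁ c hc hLc
  let s : Set K := K.subtypeL ⁻¹' Metric.ball 0 ρ
  have hs : IsOpen s := Metric.isOpen_ball.preimage K.subtypeL.continuous
  have hs0 : (0 : K) ∈ s := by simpa [s] using hρ
  have hsc : Convex ℝ s :=
    (convex_ball (0 : Fin d → ℂ) ρ).linear_preimage (K.subtype.restrictScalars ℝ)
  have hhK : DifferentiableOn ℂ (fun z : K => h (K.subtypeL z)) s :=
    hh.comp K.subtypeL.differentiableOn fun _ hz => hz
  have h3 : (fun z : K => h (K.subtypeL z)) =ᶠ[genericNhds K] fun _ => 0 := by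
    filter_upwards [hne, genericNhds_le_nhds (hι.eventually h2)] with z hz hz'
    have hLz : L (K.subtypeL z) = 0 := z.2
    rw [hLz, zero_mul, mul_zero] at hz'
    exact (mul_eq_zero.1 hz').resolve_left hz
  have h4 := eventuallyEq_nhds_of_generic (hs.mem_nhds hs0) hhK.continuousOn continuousOn_const h3
  intro z hz hLz
  exact eqOn_zero_of_eventuallyEq_zero hs hsc hs0 hhK h4 (x := (⟨z, hLz⟩ : K)) hz

/-- Let `gₙ = L₁ ⋯ L_M fₙ` be uniformly convergent holomorphic functions, where the `fₙ` are
meromorphic with poles on the hyperplanes of `𝓛`. Then the `fₙ` have a common denominator `P`, a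
product of forms in `𝓛`, such that the functions `P fₙ` are holomorphic and uniformly convergent
on a smaller ball. Indeed, those `Lᵢ` that are proportional to forms in `𝓛` go into `P`, and the
other ones divide the numerators. -/
theorem exists_common_denominator (h𝓛 : ∀ L ∈ 𝓛, L ≠ 0) {M : ℕ}
    (L : Fin M → ((Fin d → ℂ) →L[ℂ] ℂ)) (hL : ∀ m, L m ≠ 0) {ρ : ℝ} (hρ : 0 < ρ)
    {g : ℕ → (Fin d → ℂ) → ℂ} {g' : (Fin d → ℂ) → ℂ}
    (hg : ∀ n, DifferentiableOn ℂ (g n) (Metric.ball 0 ρ))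
    (hlim : TendstoUniformlyOn g g' atTop (Metric.ball 0 ρ)) (f : ℕ → (Fin d → ℂ) → ℂ)
    (hf : ∀ n, ∃ P ∈ formMonoid 𝓛, ∃ (k : (Fin d → ℂ) → ℂ) (r : ℝ), 0 < r ∧
      ContinuousOn k (Metric.ball 0 r) ∧ (fun z => P z * f n z) =ᶠ[genericNhds (Fin d → ℂ)] k)
    (hgf : ∀ n, g n =ᶠ[genericNhds (Fin d → ℂ)] fun z => (∏ m, L m z) * f n z) :
    ∃ ρ' > 0, ∃ P ∈ formMonoid 𝓛, ∃ (h : ℕ → (Fin d → ℂ) → ℂ) (h' : (Fin d → ℂ) → ℂ),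
      (∀ n, DifferentiableOn ℂ (h n) (Metric.ball 0 ρ')) ∧
      TendstoUniformlyOn h h' atTop (Metric.ball 0 ρ') ∧
      (∀ n, (fun z => P z * f n z) =ᶠ[genericNhds (Fin d → ℂ)] h n) ∧
      (fun z => P z * g' z) =ᶠ[genericNhds (Fin d → ℂ)] fun z => h' z * ∏ m, L m z := by
  induction M generalizing f with
  | zero =>
    refine ⟨ρ, hρ, 1, one_mem _, g, g', hg, hlim, fun n => ?_, by simp⟩
    filter_upwards [hgf n] with z hz
    simp [hz]
  | succ M ih =>
    obtain ⟨ρ₁, hρ₁, P, hP, h, h', hh, hhlim, hPf, hPg⟩ := ih (fun m => L m.succ)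
      (fun m => hL m.succ) (fun n z => L 0 z * f n z)
      (fun n => by
        obtain ⟨P, hP, k, r, hr, hk, hPk⟩ := hf n
        refine ⟨P, hP, fun z => L 0 z * k z, r, hr, (L 0).continuous.continuousOn.mul hk, ?_⟩
        filter_upwards [hPk] with z hz
        rw [← hz]
        ring)
      (fun n => by
        filter_upwards [hgf n] with z hz
        rw [hz, Fin.prod_univ_succ]
        ring)
    by_cases hprop : ∃ L₁ ∈ 𝓛, ∃ c : ℂ, c ≠ 0 ∧ L 0 = c • L₁
    · obtain ⟨L₁, hL₁, c, hc, hLc⟩ := hprop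
      refine ⟨ρ₁, hρ₁, P * L₁, mul_mem hP (coe_mem_formMonoid hL₁), fun n z => c⁻¹ • h n z,
        fun z => c⁻¹ • h' z, fun n => (hh n).fun_const_smul _,
        (uniformContinuous_const_smul c⁻¹).comp_tendstoUniformlyOn hhlim, fun n => ?_, ?_⟩
      · filter_upwards [hPf n] with z hz
        rw [← hz, hLc]
        simp
        field_simp
      · filter_upwards [hPg] with z hz
        rw [Fin.prod_univ_succ, hLc]
        simp only [Pi.mul_apply, smul_apply, smul_eq_mul]
        rw [mul_right_comm, hz]
        field_simp
    · push Not at hprop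
      obtain ⟨D, ρ₂, C, hρ₂, hle, hC, hD, hmul, hbound⟩ := exists_division (hL 0) hρ₁
      have hh' : DifferentiableOn ℂ h' (Metric.ball 0 ρ₁) :=
        differentiableOn_of_tendstoUniformlyOn Metric.isOpen_ball hh hhlim
      have hvan : ∀ n, ∀ z ∈ Metric.ball (0 : Fin d → ℂ) ρ₁, L 0 z = 0 → h n z = 0 := fun n => by
        obtain ⟨P', hP', k, r, hr, hk, hPk⟩ := hf n
        exact eq_zero_on_ker_of_coprime h𝓛 (hL 0) hprop hP hP' hρ₁ hr (hh n) hk (hPf n) hPk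
      have hvan' : ∀ z ∈ Metric.ball (0 : Fin d → ℂ) ρ₁, L 0 z = 0 → h' z = 0 := fun z hz hLz => by
        refine tendsto_nhds_unique (hhlim.tendsto_at hz) ?_
        simp only [hvan _ z hz hLz]
        exact tendsto_const_nhds
      have hball : ∀ᶠ z in genericNhds (Fin d → ℂ), z ∈ Metric.ball (0 : Fin d → ℂ) ρ₂ :=
        genericNhds_le_nhds (Metric.ball_mem_nhds 0 hρ₂)
      refine ⟨ρ₂, hρ₂, P, hP, fun n => D (h n), D h', fun n => hD _ (hh n), ?_, fun n => ?_, ?_⟩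
      · rw [Metric.tendstoUniformlyOn_iff] at hhlim ⊢
        intro ε hε
        filter_upwards [hhlim (ε / (2 * C)) (by positivity)] with n hn z hz
        have := hbound h' (h n) (ε / (2 * C)) hh' (hh n)
          (fun w hw => by rw [← dist_eq_norm]; exact (hn w hw).le) z hz
        rw [dist_eq_norm]
        refine this.trans_lt ?_
        have : C * (ε / (2 * C)) = ε / 2 := by field_simp
        linarith
      · filter_upwards [hPf n, hball, eventually_genericNhds_ne_zero (hL 0)] with z hz hzb hz0
        have := hmul (h n) (hh n) (hvan n) z hzb
        rw [← hz] at this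
        refine (mul_left_cancel₀ hz0 ?_).symm
        rw [this]
        ring
      · filter_upwards [hPg, hball] with z hz hzb
        rw [hz, Fin.prod_univ_succ, ← hmul h' hh' hvan' z hzb]
        ring

/-- A continuous function is real at real points near zero if its product with a product of real
linear forms is. -/
theorem im_eq_zero_of_mul (h𝓛 : ∀ L ∈ 𝓛, L ≠ 0)
    (hre : ∀ L ∈ 𝓛, ∀ z : Fin d → ℂ, (∀ i, (z i).im = 0) → (L z).im = 0)
    {P : (Fin d → ℂ) → ℂ} (hP : P ∈ formMonoid 𝓛) {ρ : ℝ} {h : (Fin d → ℂ) → ℂ}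
    (hh : ContinuousOn h (Metric.ball 0 ρ))
    (hPh : ∀ z ∈ Metric.ball (0 : Fin d → ℂ) ρ, (∀ i, (z i).im = 0) → (P z * h z).im = 0) :
    ∀ z ∈ Metric.ball (0 : Fin d → ℂ) ρ, (∀ i, (z i).im = 0) → (h z).im = 0 := by
  induction hP using Submonoid.closure_induction generalizing h with
  | one => simpa using hPh
  | mul x y hx hy ihx ihy =>
    refine ihy hh (ihx (((differentiable_of_mem_formMonoid hy).continuous.continuousOn).mul hh)
      fun z hz hzr => ?_)
    simpa [mul_assoc] using hPh z hz hzr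
  | mem x hx =>
    obtain ⟨L, hL, rfl⟩ := hx
    -- Some vector of the standard basis is not in the kernel of `L`.
    obtain ⟨i, hi⟩ : ∃ i, L (Pi.single i 1) ≠ 0 := by
      by_contra! hcon
      refine h𝓛 L hL (ContinuousLinearMap.coe_injective ((Pi.basisFun ℂ (Fin d)).ext fun i => ?_))
      simpa using hcon i
    have hnz : ∀ z ∈ Metric.ball (0 : Fin d → ℂ) ρ, (∀ i, (z i).im = 0) → L z ≠ 0 →
        (h z).im = 0 := fun z hz hzr hLz => by
      have h1 := hPh z hz hzr
      have h2 := hre L hL z hzr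
      rw [Complex.mul_im, h2, zero_mul, add_zero] at h1
      refine (mul_eq_zero.1 h1).resolve_left fun h3 => hLz (Complex.ext h3 h2)
    intro z hz hzr
    by_cases hLz : L z = 0
    · let γ : ℝ → Fin d → ℂ := fun s => z + (s : ℂ) • Pi.single i 1
      have hγ : Tendsto γ (𝓝[≠] 0) (𝓝 z) := by
        have hc : Continuous γ := by fun_prop
        simpa [γ] using (hc.tendsto 0).mono_left nhdsWithin_le_nhds
      have hzn := Metric.isOpen_ball.mem_nhds hz
      have h1 : Tendsto (fun s => (h (γ s)).im) (𝓝[≠] 0) (𝓝 (h z).im) :=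
        (Complex.continuous_im.tendsto _).comp (((hh.continuousAt hzn).tendsto).comp hγ)
      refine tendsto_nhds_unique h1 (tendsto_const_nhds.congr' ?_)
      filter_upwards [hγ hzn, self_mem_nhdsWithin] with s hs hs0
      refine (hnz _ hs (fun j => ?_) ?_).symm
      · by_cases hj : j = i
        · subst hj
          simp [γ, hzr]
        · simp [γ, hzr, hj]
      · have hs0' : (s : ℂ) ≠ 0 := by exact_mod_cast hs0
        simp [γ, hLz, hi, hs0']
    · exact hnz z hz hzr hLz

end DivisionLimit

/-! ### Sequences of meromorphic germs -/

section Mero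

variable {d : ℕ} {Q : InnerProductSpace.Core ℂ (Fin d → ℂ)} {𝓛 : Set ((Fin d → ℂ) →L[ℂ] ℂ)}

/-- A meromorphic germ is the generic germ of a function with a real continuous numerator and a
product of forms in `𝓛` as its denominator. -/
theorem Mero.exists_rep (h𝓛 : ∀ L ∈ 𝓛, L ≠ 0)
    (hre : ∀ L ∈ 𝓛, ∀ z : Fin d → ℂ, (∀ i, (z i).im = 0) → (L z).im = 0) (f : Mero Q 𝓛) :
    ∃ F : (Fin d → ℂ) → ℂ, (f : PGerm (Fin d → ℂ)) = (F : PGerm (Fin d → ℂ)) ∧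
      ∃ P ∈ formMonoid 𝓛, ∃ (k : (Fin d → ℂ) → ℂ) (r : ℝ), 0 < r ∧
        ContinuousOn k (Metric.ball 0 r) ∧
        (∀ z ∈ Metric.ball (0 : Fin d → ℂ) r, (∀ i, (z i).im = 0) → (k z).im = 0) ∧
        (fun z => P z * F z) =ᶠ[genericNhds (Fin d → ℂ)] k := by
  obtain ⟨f, hf⟩ := f
  simp only
  refine Submodule.iSup_induction _ (motive := fun f : PGerm (Fin d → ℂ) =>
    ∃ F : (Fin d → ℂ) → ℂ, f = (F : PGerm (Fin d → ℂ)) ∧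
      ∃ P ∈ formMonoid 𝓛, ∃ (k : (Fin d → ℂ) → ℂ) (r : ℝ), 0 < r ∧
        ContinuousOn k (Metric.ball 0 r) ∧
        (∀ z ∈ Metric.ball (0 : Fin d → ℂ) r, (∀ i, (z i).im = 0) → (k z).im = 0) ∧
        (fun z => P z * F z) =ᶠ[genericNhds (Fin d → ℂ)] k) hf ?_ ?_ ?_
  · rintro ⟨n, P⟩ _ ⟨u, rfl⟩
    obtain ⟨r, hr, hrsub⟩ := Metric.mem_nhds_iff.1 (qball_mem_nhds Q (one_div_nat_pos n))
    refine ⟨_, rfl, P.1, formProducts_subset_formMonoid P.2,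
      zeroExt (qball Q (1 / ((n : ℝ) + 1))) u.1, r, hr,
      (BHol.differentiableOn u).continuousOn.mono hrsub,
      fun z hz hzr => BHol.im_eq_zero u (hrsub hz) hzr, ?_⟩
    filter_upwards [eventually_ne_zero_of_mem_formMonoid h𝓛
      (formProducts_subset_formMonoid P.2)] with z hz
    exact mul_div_cancel₀ _ hz
  · exact ⟨0, rfl, 1, one_mem _, 0, 1, one_pos, continuousOn_const, fun _ _ _ => rfl,
      Eventually.of_forall fun z => by simp⟩
  · rintro _ _ ⟨F₁, rfl, P₁, hP₁, k₁, r₁, hr₁, hk₁, hre₁, h₁⟩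
      ⟨F₂, rfl, P₂, hP₂, k₂, r₂, hr₂, hk₂, hre₂, h₂⟩
    have hs₁ : Metric.ball (0 : Fin d → ℂ) (min r₁ r₂) ⊆ Metric.ball 0 r₁ :=
      Metric.ball_subset_ball (min_le_left _ _)
    have hs₂ : Metric.ball (0 : Fin d → ℂ) (min r₁ r₂) ⊆ Metric.ball 0 r₂ :=
      Metric.ball_subset_ball (min_le_right _ _)
    refine ⟨F₁ + F₂, rfl, P₁ * P₂, mul_mem hP₁ hP₂, fun z => P₂ z * k₁ z + P₁ z * k₂ z,
      min r₁ r₂, lt_min hr₁ hr₂, ?_, fun z hz hzr => ?_, ?_⟩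
    · exact ((differentiable_of_mem_formMonoid hP₂).continuous.continuousOn.mul
        (hk₁.mono hs₁)).add ((differentiable_of_mem_formMonoid hP₁).continuous.continuousOn.mul
        (hk₂.mono hs₂))
    · simp [im_eq_zero_of_mem_formMonoid hre hP₁ hzr, im_eq_zero_of_mem_formMonoid hre hP₂ hzr,
        hre₁ z (hs₁ hz) hzr, hre₂ z (hs₂ hz) hzr]
    · filter_upwards [h₁, h₂] with z hz₁ hz₂
      rw [← hz₁, ← hz₂]
      simp only [Pi.mul_apply, Pi.add_apply]
      ring

/-- Limits of sequences of meromorphic germs whose products with fixed linear forms converge as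
holomorphic germs: the convergence takes place in one of the steps. -/
theorem Mero.exists_step_tendsto (h𝓛 : ∀ L ∈ 𝓛, L ≠ 0)
    (hre : ∀ L ∈ 𝓛, ∀ z : Fin d → ℂ, (∀ i, (z i).im = 0) → (L z).im = 0)
    (hne : 𝓛.Nonempty) {M : ℕ} (L : Fin M → ((Fin d → ℂ) →L[ℂ] ℂ)) (hL : ∀ m, L m ≠ 0)
    (f : ℕ → Mero Q 𝓛) (g : ℕ → Holo Q) (g' : Holo Q)
    (hgf : ∀ n, (g n : PGerm (Fin d → ℂ)) =
      ((fun z => ∏ m, L m z : (Fin d → ℂ) → ℂ) : PGerm (Fin d → ℂ)) *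
        (f n : PGerm (Fin d → ℂ)))
    (hg : Tendsto g atTop (𝓝 g')) :
    ∃ (i : ℕ × formProducts 𝓛) (y : ℕ → BHol Q (1 / ((i.1 : ℝ) + 1)))
      (y' : BHol Q (1 / ((i.1 : ℝ) + 1))), (∀ n, Mero.step Q 𝓛 i (y n) = f n) ∧
      (Mero.step Q 𝓛 i y' : PGerm (Fin d → ℂ)) = (g' : PGerm (Fin d → ℂ)) /
        ((fun z => ∏ m, L m z : (Fin d → ℂ) → ℂ) : PGerm (Fin d → ℂ)) ∧
      Tendsto y atTop (𝓝 y') := by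
  obtain ⟨N, x, x', hx, hx', hxlim⟩ := (isCompactSystem_holo Q).exists_tendsto hg
  obtain ⟨ρ, hρ, hρsub⟩ := Metric.mem_nhds_iff.1 (qball_mem_nhds Q (one_div_nat_pos N))
  choose F hF hFrep using fun n => Mero.exists_rep h𝓛 hre (f n)
  have hxu : TendstoUniformlyOn (fun n => zeroExt (qball Q (1 / ((N : ℝ) + 1))) (x n))
      (zeroExt (qball Q (1 / ((N : ℝ) + 1))) x') atTop (Metric.ball 0 ρ) := by
    rw [Metric.tendstoUniformlyOn_iff]
    intro ε hε
    filter_upwards [Metric.tendsto_nhds.1 hxlim ε hε] with n hn z hz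
    rw [dist_comm, dist_eq_norm]
    rw [dist_eq_norm] at hn
    have := BHol.norm_apply_le (x n - x') (hρsub hz)
    rw [Submodule.coe_sub, map_sub] at this
    exact this.trans_lt hn
  have hgF : ∀ n, zeroExt (qball Q (1 / ((N : ℝ) + 1))) (x n) =ᶠ[genericNhds (Fin d → ℂ)]
      fun z => (∏ m, L m z) * F n z := fun n => by
    have h1 := hgf n
    rw [← hx n, hF n] at h1
    filter_upwards [Germ.coe_eq.1 h1] with z hz
    simpa using hz
  obtain ⟨ρ', hρ', P, hP, h, h', hh, hhlim, hPF, hPg⟩ := exists_common_denominator h𝓛 L hL hρ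
    (fun n => (BHol.differentiableOn (x n)).mono hρsub) hxu F
    (fun n => by
      obtain ⟨P, hP, k, r, hr, hk, -, hPk⟩ := hFrep n
      exact ⟨P, hP, k, r, hr, hk, hPk⟩) hgF
  have hh' : DifferentiableOn ℂ h' (Metric.ball 0 ρ') :=
    differentiableOn_of_tendstoUniformlyOn Metric.isOpen_ball hh hhlim
  have hreal : ∀ n, ∀ z ∈ Metric.ball (0 : Fin d → ℂ) ρ', (∀ i, (z i).im = 0) →
      (h n z).im = 0 := by
    intro n
    obtain ⟨P₁, hP₁, k, r, hr, hk, hkre, hPk⟩ := hFrep n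
    have h1 : (fun z => P₁ z * h n z) =ᶠ[𝓝 0] fun z => P z * k z := by
      refine eventuallyEq_nhds_of_generic
        (inter_mem (Metric.ball_mem_nhds 0 hρ') (Metric.ball_mem_nhds 0 hr)) ?_ ?_ ?_
      · exact ((differentiable_of_mem_formMonoid hP₁).continuous.continuousOn).mul
          ((hh n).continuousOn.mono Set.inter_subset_left)
      · exact ((differentiable_of_mem_formMonoid hP).continuous.continuousOn).mul
          (hk.mono Set.inter_subset_right)
      · filter_upwards [hPF n, hPk] with z hz hz'
        rw [← hz, ← hz']
        ring
    obtain ⟨δ, hδ, hδsub⟩ := Metric.mem_nhds_iff.1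
      (inter_mem (inter_mem (Metric.ball_mem_nhds 0 hρ') (Metric.ball_mem_nhds 0 hr)) h1)
    have h2 : ∀ z ∈ Metric.ball (0 : Fin d → ℂ) δ, (∀ i, (z i).im = 0) → (h n z).im = 0 := by
      refine im_eq_zero_of_mul h𝓛 hre hP₁
        ((hh n).continuousOn.mono fun z hz => (hδsub hz).1.1) fun z hz hzr => ?_
      have h3 : P₁ z * h n z = P z * k z := (hδsub hz).2
      rw [h3, Complex.mul_im, im_eq_zero_of_mem_formMonoid hre hP hzr,
        hkre z (hδsub hz).1.2 hzr]
      simp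
    intro z hz hzr
    refine im_eq_zero_of_eventually Metric.isOpen_ball (convex_ball _ _)
      (Metric.mem_ball_self hρ') (hh n) hz ?_
    have hc : Continuous fun t : ℝ => (t : ℂ) • z := by fun_prop
    have ht : Tendsto (fun t : ℝ => (t : ℂ) • z) (𝓝 0) (𝓝 0) := by simpa using hc.tendsto 0
    filter_upwards [ht (Metric.ball_mem_nhds 0 hδ)] with t ht
    exact h2 _ ht fun i => by simp [hzr]
  have hreal' : ∀ z ∈ Metric.ball (0 : Fin d → ℂ) ρ', (∀ i, (z i).im = 0) → (h' z).im = 0 := by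
    intro z hz hzr
    refine tendsto_nhds_unique ((Complex.continuous_im.tendsto _).comp (hhlim.tendsto_at hz)) ?_
    simp only [Function.comp_def, hreal _ z hz hzr]
    exact tendsto_const_nhds
  -- An additional factor from `𝓛` makes the denominator a nonempty product.
  obtain ⟨L₀, hL₀⟩ := hne
  have hP₀ : P * L₀ ∈ formProducts 𝓛 := mul_mem_formProducts hP (coe_mem_formProducts hL₀)
  obtain ⟨N', hN'⟩ := exists_nat_qball_subset Q (half_pos hρ')
  have hsub : qball Q (1 / ((N' : ℝ) + 1)) ⊆ Metric.closedBall 0 (ρ' / 2) :=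
    (hN' N' le_rfl).trans Metric.ball_subset_closedBall
  have hsub' : Metric.closedBall (0 : Fin d → ℂ) (ρ' / 2) ⊆ Metric.ball 0 ρ' :=
    Metric.closedBall_subset_ball (by linarith)
  have hex : ∀ u : (Fin d → ℂ) → ℂ, DifferentiableOn ℂ u (Metric.ball 0 ρ') →
      (∀ z ∈ Metric.ball (0 : Fin d → ℂ) ρ', (∀ i, (z i).im = 0) → (u z).im = 0) →
      ∃ y : BHol Q (1 / ((N' : ℝ) + 1)), ∀ z ∈ qball Q (1 / ((N' : ℝ) + 1)),
        zeroExt (qball Q (1 / ((N' : ℝ) + 1))) y z = u z * L₀ z := by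
    intro u hu hur
    have hd : DifferentiableOn ℂ (fun z => u z * L₀ z) (Metric.ball 0 ρ') :=
      hu.mul L₀.differentiableOn
    obtain ⟨B, hB⟩ := (isCompact_closedBall (0 : Fin d → ℂ) (ρ' / 2)).exists_bound_of_continuousOn
      (hd.continuousOn.mono hsub')
    refine BHol.exists_of_bounded (hd.mono (hsub.trans hsub')) (fun z hz => hB z (hsub hz))
      fun z hz hzr => ?_
    rw [Complex.mul_im, hur z (hsub' (hsub hz)) hzr, hre L₀ hL₀ z hzr]
    simp
  choose y hy using fun n => hex (h n) (hh n) (hreal n)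
  obtain ⟨y', hy'⟩ := hex h' hh' hreal'
  have hball : ∀ᶠ z in genericNhds (Fin d → ℂ), z ∈ qball Q (1 / ((N' : ℝ) + 1)) :=
    genericNhds_le_nhds (qball_mem_nhds Q (one_div_nat_pos N'))
  have hP0 := eventually_ne_zero_of_mem_formMonoid h𝓛 hP
  have hL₀0 := eventually_genericNhds_ne_zero (h𝓛 L₀ hL₀)
  refine ⟨(N', ⟨P * L₀, hP₀⟩), y, y', fun n => Subtype.ext ?_, ?_, ?_⟩
  · rw [hF n]
    refine Germ.coe_eq.2 ?_
    filter_upwards [hball, hP0, hL₀0, hPF n] with z hz hPz hLz hzF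
    rw [hy n z hz, ← hzF, Pi.mul_apply]
    field_simp
  · rw [← hx']
    have hprod : ∀ᶠ z in genericNhds (Fin d → ℂ), ∏ m, L m z ≠ 0 := by
      have := eventually_all.2 fun m => eventually_genericNhds_ne_zero (hL m)
      filter_upwards [this] with z hz
      exact Finset.prod_ne_zero_iff.2 fun m _ => hz m
    refine Germ.coe_eq.2 ?_
    filter_upwards [hball, hP0, hL₀0, hPg, hprod] with z hz hPz hLz hzg hLp
    have hzg' : h' z * ∏ m, L m z = P z * zeroExt (qball Q (1 / ((N : ℝ) + 1))) x' z := hzg.symm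
    rw [hy' z hz, Pi.mul_apply, Pi.one_apply, div_one, mul_div_mul_right _ _ hLz,
      div_eq_div_iff hPz hLp, hzg', mul_comm]
  · obtain ⟨B, hB⟩ := (isCompact_closedBall (0 : Fin d → ℂ) (ρ' / 2)).exists_bound_of_continuousOn
      L₀.continuous.continuousOn
    rw [Metric.tendsto_nhds]
    intro ε hε
    have hB1 : 0 < |B| + 1 := by positivity
    filter_upwards [Metric.tendstoUniformlyOn_iff.1 hhlim (ε / 2 / (|B| + 1)) (by positivity)]
      with n hn
    rw [dist_eq_norm]
    refine (BHol.norm_le (y n - y') (half_pos hε).le fun z hz => ?_).trans_lt (half_lt_self hε)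
    rw [Submodule.coe_sub, map_sub, Pi.sub_apply, hy n z hz, hy' z hz, ← sub_mul, norm_mul]
    have h1 := hn z (hsub' (hsub hz))
    rw [dist_comm, dist_eq_norm] at h1
    have h2 : ‖L₀ z‖ ≤ |B| + 1 := (hB z (hsub hz)).trans (by linarith [le_abs_self B])
    calc ‖h n z - h' z‖ * ‖L₀ z‖ ≤ ε / 2 / (|B| + 1) * (|B| + 1) := by gcongr
      _ = ε / 2 := by field_simp

end Mero

/-! ### Continuity of maps on germs in infinitely many variables -/

section Continuity

variable {Q : ∀ k : ℕ, InnerProductSpace.Core ℂ (Fin (k + 1) → ℂ)} {Λ : GeneratingFamily}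

theorem IsSilva.of_subsingleton {E : Type*} [AddCommGroup E] [Module ℝ E] [TopologicalSpace E]
    [Subsingleton E] : IsSilva E :=
  ⟨inferInstance, fun _ => PUnit, fun _ => inferInstance, fun _ => inferInstance,
    fun _ => inferInstance, fun _ => 0, fun _ => 0, fun _ => isCompactOperator_zero,
    fun _ => Function.injective_of_subsingleton _, fun _ _ => rfl,
    fun y => ⟨0, 0, Subsingleton.elim _ y⟩, Subsingleton.elim _ _⟩

theorem MeroLim.subsingleton [IsEmpty (Σ k : ℕ, ℕ × formProducts (Λ.forms k))] :
    Subsingleton (MeroLim Q Λ) := by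
  have h := MeroLim.iSup_range_step Q Λ
  rw [iSup_of_empty] at h
  exact (Submodule.subsingleton_iff ℝ).1 (subsingleton_of_bot_eq_top h)

theorem Mero.subsingleton {d : ℕ} {Q : InnerProductSpace.Core ℂ (Fin d → ℂ)} :
    Subsingleton (Mero Q ∅) := by
  have : IsEmpty (formProducts (∅ : Set ((Fin d → ℂ) →L[ℂ] ℂ))) :=
    ⟨by rintro ⟨_, m, L, hL, -⟩; exact hL 0⟩
  have h : Mero Q ∅ = ⊥ := iSup_of_empty _
  rw [h]
  infer_instance

variable (Q Λ) in
theorem isSilva_meroLim : IsSilva (MeroLim Q Λ) := by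
  rcases isEmpty_or_nonempty (Σ k : ℕ, ℕ × formProducts (Λ.forms k)) with hJ | hJ
  · have := MeroLim.subsingleton (Q := Q) (Λ := Λ)
    exact IsSilva.of_subsingleton
  · have := countable_index Λ
    have h := (isCompactSystem_meroLim Q Λ).isSilva
    rwa [← MeroLim.topology_eq] at h

theorem MeroLim.continuous_iff {φ : MeroLim Q Λ → ℂ} :
    Continuous φ ↔ ∀ i, Continuous fun f => φ (MeroLim.step Q Λ i f) := by
  rcases isEmpty_or_nonempty (Σ k : ℕ, ℕ × formProducts (Λ.forms k)) with hJ | hJ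
  · have := MeroLim.subsingleton (Q := Q) (Λ := Λ)
    exact ⟨fun _ i => isEmptyElim i, fun _ => continuous_of_discreteTopology⟩
  · have := countable_index Λ
    have h := (isCompactSystem_meroLim Q Λ).continuous_iff (φ := φ)
    rwa [← MeroLim.topology_eq] at h

theorem MeroLim.continuous_incl (k : ℕ) : Continuous (MeroLim.incl Q Λ k) :=
  continuous_lcFinal (MeroLim.incl Q Λ) k

theorem MeroLim.continuous_iff_incl {φ : MeroLim Q Λ → ℂ} :
    Continuous φ ↔ ∀ k, Continuous fun f => φ (MeroLim.incl Q Λ k f) :=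
  ⟨fun h k => h.comp (MeroLim.continuous_incl k), fun h => MeroLim.continuous_iff.2 fun i =>
    (h i.1).comp (continuous_lcFinal (Mero.step (Q i.1) (Λ.forms i.1)) i.2)⟩

/-- If there are no forms at all, then the only meromorphic germ is zero, and the limit is zero
because the space of holomorphic germs is Hausdorff. -/
theorem respectsLimits_of_continuous {φ : MeroLim Q Λ → ℂ} (hφ : Continuous φ) (k : ℕ) {M : ℕ}
    (L : Fin M → ((Fin (k + 1) → ℂ) →L[ℂ] ℂ)) (hL : ∀ m, L m ≠ 0) :
    RespectsLimits Q Λ φ k L := by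
  intro f g g' hgf hg
  rcases Set.eq_empty_or_nonempty (Λ.forms k) with hemp | hne
  · have hss : Subsingleton (Mero (Q k) (Λ.forms k)) := hemp ▸ Mero.subsingleton
    have hf : ∀ n, f n = 0 := fun n => Subsingleton.elim _ _
    have hg0 : ∀ n, g n = 0 := fun n => Subtype.ext (by
      rw [hgf n, hf n, Submodule.coe_zero, mul_zero, Submodule.coe_zero])
    have hT2 : T2Space (Holo (Q k)) := (isCompactSystem_holo (Q k)).isSilva.1
    have hg'0 : g' = 0 := by
      refine tendsto_nhds_unique hg ?_
      simp only [funext hg0]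
      exact tendsto_const_nhds
    refine ⟨0, ?_, ?_⟩
    · rw [hg'0, Submodule.coe_zero, Submodule.coe_zero]
      refine Germ.coe_eq.2 (Eventually.of_forall fun z => ?_)
      simp
    · simp only [hf]
      exact tendsto_const_nhds
  · obtain ⟨i, y, y', hy, hy', hlim⟩ := Mero.exists_step_tendsto (Λ.ne_zero k) (Λ.real k) hne L hL
      f g g' hgf hg
    refine ⟨_, hy', ?_⟩
    have hc : Continuous fun u => φ (MeroLim.incl Q Λ k (Mero.step (Q k) (Λ.forms k) i u)) :=
      MeroLim.continuous_iff.1 hφ ⟨k, i⟩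
    simpa only [Function.comp_def, hy] using (hc.tendsto y').comp hlim

/-- A convergent sequence of numerators in the step `(k, n, P)` is a convergent sequence of
holomorphic germs, to which the hypothesis on the factors of `P` applies. -/
theorem continuous_of_respectsLimits {φ : MeroLim Q Λ → ℂ}
    (h : ∀ (k M : ℕ) (L : Fin M → ((Fin (k + 1) → ℂ) →L[ℂ] ℂ)), (∀ m, L m ∈ Λ.forms k) →
      RespectsLimits Q Λ φ k L) : Continuous φ := by
  refine MeroLim.continuous_iff.2 ?_
  rintro ⟨k, n, P⟩
  refine SeqContinuous.continuous fun x x' hx => ?_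
  obtain ⟨m, L, hL, hP⟩ := P.2
  have hne : ∀ᶠ z in genericNhds (Fin (k + 1) → ℂ), P.1 z ≠ 0 :=
    eventually_ne_zero_of_mem_formMonoid (Λ.ne_zero k) (formProducts_subset_formMonoid P.2)
  obtain ⟨u, hu, hlim⟩ := h k (m + 1) L hL (fun j => Mero.step (Q k) (Λ.forms k) (n, P) (x j))
    (fun j => Holo.step (Q k) n (x j)) (Holo.step (Q k) n x')
    (fun j => by
      rw [← hP]
      refine Germ.coe_eq.2 ?_
      filter_upwards [hne] with z hz
      rw [Pi.one_apply, div_one]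
      exact (mul_div_cancel₀ _ hz).symm)
    (((continuous_lcFinal (Holo.step (Q k)) n).tendsto x').comp hx)
  have hu' : u = Mero.step (Q k) (Λ.forms k) (n, P) x' := by
    refine Subtype.ext (hu.trans ?_)
    rw [← hP]
    refine Germ.coe_eq.2 (Eventually.of_forall fun z => ?_)
    change _ / (1 : (Fin (k + 1) → ℂ) → ℂ) z / P.1 z = _
    rw [Pi.one_apply, div_one]
  rw [hu'] at hlim
  exact hlim

end Continuity

end MeroGerms

end

theorem proposition2p4
    (Q : ∀ k : ℕ, InnerProductSpace.Core ℂ (Fin (k + 1) → ℂ))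
    (Λ : MeroGerms.GeneratingFamily) :
    MeroGerms.IsSilva (MeroGerms.MeroLim Q Λ) ∧
    ∀ φ : MeroGerms.MeroLim Q Λ → ℂ,
      (Continuous φ ↔ ∀ k, Continuous fun f => φ (MeroGerms.MeroLim.incl Q Λ k f)) ∧
      (Continuous φ ↔
        ∀ (k M : ℕ) (L : Fin M → ((Fin (k + 1) → ℂ) →L[ℂ] ℂ)),
          (∀ m, L m ≠ 0) → MeroGerms.RespectsLimits Q Λ φ k L) ∧
      (Continuous φ ↔
        ∀ (k M : ℕ) (L : Fin M → ((Fin (k + 1) → ℂ) →L[ℂ] ℂ)),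
          (∀ m, L m ∈ Λ.forms k) → MeroGerms.RespectsLimits Q Λ φ k L) :=
  ⟨MeroGerms.isSilva_meroLim Q Λ, fun _ =>
    ⟨MeroGerms.MeroLim.continuous_iff_incl,
      ⟨fun h k _ L hL => MeroGerms.respectsLimits_of_continuous h k L hL,
        fun h => MeroGerms.continuous_of_respectsLimits fun k M L hL =>
          h k M L fun m => Λ.ne_zero k _ (hL m)⟩,
      ⟨fun h k _ L hL =>
          MeroGerms.respectsLimits_of_continuous h k L fun m => Λ.ne_zero k _ (hL m),
        MeroGerms.continuous_of_respectsLimits⟩⟩⟩
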